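/- Let $k$ be a field and let $A$ be a finite-dimensional self-injective $k$-algebra (i.e. all projective $A$-modules are injective; modules are right modules) satisfying the condition (#): for every finitely generated non-projective $A$-module $M$ there are infinitely many integers $n$ with $\operatorname{Ext}^n_A(M,M)\neq 0$. View $K^b(P_A)$, the homotopy category of bounded complexes of finitely generated projective $A$-modules, and $\mathcal D^b(\mathrm{mod}\text{-}A)$, the bounded derived category of finitely generated $A$-modules, as full subcategories (closed under isomorphism) of the unbounded derived category $\mathcal D(\mathrm{Mod}\text{-}A)$ of all $A$-modules. Then: (a) For every $X\in\mathcal D^b(\mathrm{mod}\text{-}A)$, either $X\in K^b(P_A)$ or there are infinitely many integers $n$ with $\operatorname{Hom}(X,X[n])\neq 0$. (b) Let $B$ and $C$ be finite-dimensional $k$-algebras and suppose given a recollement of triangulated categories of the form (R2), that is, of $\mathcal D(\mathrm{Mod}\text{-}A)$ by $\mathcal D(\mathrm{Mod}\text{-}B)$ and $\mathcal D(\mathrm{Mod}\text{-}C)$: triangle functors $i^*,i^!:\mathcal D(\mathrm{Mod}\text{-}A)\to\mathcal D(\mathrm{Mod}\text{-}B)$, $i_*=i_!:\mathcal D(\mathrm{Mod}\text{-}B)\to\mathcal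 D(\mathrm{Mod}\text{-}A)$, $j^!=j^*:\mathcal D(\mathrm{Mod}\text{-}A)\to\mathcal D(\mathrm{Mod}\text{-}C)$ and $j_!,j_*:\mathcal D(\mathrm{Mod}\text{-}C)\to\mathcal D(\mathrm{Mod}\text{-}A)$ such that $(i^*,i_*)$, $(i_!,i^!)$, $(j_!,j^!)$, $(j^*,j_*)$ are adjoint pairs, $i_*,j_*,j_!$ are fully faithful, $i^!j_*=0$, and every object $X$ of $\mathcal D(\mathrm{Mod}\text{-}A)$ lies in triangles $i_!i^!X\to X\to j_*j^*X\to i_!i^!X[1]$ and $j_!j^!X\to X\to i_*i^*X\to j_!j^!X[1]$ whose first two maps are the adjunction counit and unit. Assume that the recollement is nontrivial, i.e. none of $i_*,j_!,j_*$ is an equivalence. Then $i_*i^*(A)$ belongs to $K^b(P_A)$. -/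

import Mathlib

open CategoryTheory CategoryTheory.Limits MulOpposite

universe w w₁ w₂ v u

namespace DerivedSimple

/-- A recollement of the (pre)triangulated category `D` by `D'` (on the left) and `D''` (on the
right). The six functors are `iUpStar = i^*`, `iLowStar = i_* = i_!`, `iUpShriek = i^!`,
`jLowShriek = j_!`, `jUpStar = j^* = j^!` and `jLowStar = j_*`, all of them triangle functors. -/
structure Recollement (D' D D'' : Type*) [Category D'] [Category D] [Category D'']
    [HasZeroObject D'] [HasZeroObject D] [HasZeroObject D'']
    [HasShift D' ℤ] [HasShift D ℤ] [HasShift D'' ℤ]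
    [Preadditive D'] [Preadditive D] [Preadditive D'']
    [∀ n : ℤ, (shiftFunctor D' n).Additive] [∀ n : ℤ, (shiftFunctor D n).Additive]
    [∀ n : ℤ, (shiftFunctor D'' n).Additive]
    [Pretriangulated D'] [Pretriangulated D] [Pretriangulated D''] where
  iUpStar : D ⥤ D'
  iLowStar : D' ⥤ D
  iUpShriek : D ⥤ D'
  jLowShriek : D'' ⥤ D
  jUpStar : D ⥤ D''
  jLowStar : D'' ⥤ D
  [commShift_iUpStar : iUpStar.CommShift ℤ]
  [commShift_iLowStar : iLowStar.CommShift ℤ]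
  [commShift_iUpShriek : iUpShriek.CommShift ℤ]
  [commShift_jLowShriek : jLowShriek.CommShift ℤ]
  [commShift_jUpStar : jUpStar.CommShift ℤ]
  [commShift_jLowStar : jLowStar.CommShift ℤ]
  [isTriangulated_iUpStar : iUpStar.IsTriangulated]
  [isTriangulated_iLowStar : iLowStar.IsTriangulated]
  [isTriangulated_iUpShriek : iUpShriek.IsTriangulated]
  [isTriangulated_jLowShriek : jLowShriek.IsTriangulated]
  [isTriangulated_jUpStar : jUpStar.IsTriangulated]
  [isTriangulated_jLowStar : jLowStar.IsTriangulated]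
  /-- the adjoint pair `(i^*, i_*)` -/
  adj_iUpStar : iUpStar ⊣ iLowStar
  /-- the adjoint pair `(i_!, i^!)` -/
  adj_iUpShriek : iLowStar ⊣ iUpShriek
  /-- the adjoint pair `(j_!, j^!)` -/
  adj_jLowShriek : jLowShriek ⊣ jUpStar
  /-- the adjoint pair `(j^*, j_*)` -/
  adj_jLowStar : jUpStar ⊣ jLowStar
  full_iLowStar : iLowStar.Full
  faithful_iLowStar : iLowStar.Faithful
  full_jLowStar : jLowStar.Full
  faithful_jLowStar : jLowStar.Faithful
  full_jLowShriek : jLowShriek.Full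
  faithful_jLowShriek : jLowShriek.Faithful
  /-- `i^! ∘ j_* = 0` -/
  isZero_iUpShriek_jLowStar : ∀ X : D'', IsZero (iUpShriek.obj (jLowStar.obj X))
  /-- the triangle `i_! i^! X ⟶ X ⟶ j_* j^* X ⟶ (i_! i^! X)[1]`, whose first two maps are the
  counit and the unit of the adjunctions -/
  exists_triangle_shriek_star : ∀ X : D,
    ∃ δ : jLowStar.obj (jUpStar.obj X) ⟶ (iLowStar.obj (iUpShriek.obj X))⟦(1 : ℤ)⟧,
      Pretriangulated.Triangle.mk (adj_iUpShriek.counit.app X) (adj_jLowStar.unit.app X) δ ∈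
        Pretriangulated.distinguishedTriangles
  /-- the triangle `j_! j^! X ⟶ X ⟶ i_* i^* X ⟶ (j_! j^! X)[1]`, whose first two maps are the
  counit and the unit of the adjunctions -/
  exists_triangle_star_shriek : ∀ X : D,
    ∃ δ : iLowStar.obj (iUpStar.obj X) ⟶ (jLowShriek.obj (jUpStar.obj X))⟦(1 : ℤ)⟧,
      Pretriangulated.Triangle.mk (adj_jLowShriek.counit.app X) (adj_iUpStar.unit.app X) δ ∈
        Pretriangulated.distinguishedTriangles

attribute [instance] Recollement.commShift_iUpStar
  Recollement.commShift_iLowStar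
  Recollement.commShift_iUpShriek
  Recollement.commShift_jLowShriek
  Recollement.commShift_jUpStar
  Recollement.commShift_jLowStar
  Recollement.isTriangulated_iUpStar
  Recollement.isTriangulated_iLowStar
  Recollement.isTriangulated_iUpShriek
  Recollement.isTriangulated_jLowShriek
  Recollement.isTriangulated_jUpStar
  Recollement.isTriangulated_jLowStar
  Recollement.full_iLowStar
  Recollement.faithful_iLowStar
  Recollement.full_jLowStar
  Recollement.faithful_jLowStar
  Recollement.full_jLowShriek
  Recollement.faithful_jLowShriek

/-- A recollement is nontrivial if none of the full embeddings `i_*`, `j_!`, `j_*` is an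
equivalence. -/
def Recollement.IsNontrivial {D' D D'' : Type*} [Category D'] [Category D] [Category D'']
    [HasZeroObject D'] [HasZeroObject D] [HasZeroObject D'']
    [HasShift D' ℤ] [HasShift D ℤ] [HasShift D'' ℤ]
    [Preadditive D'] [Preadditive D] [Preadditive D'']
    [∀ n : ℤ, (shiftFunctor D' n).Additive] [∀ n : ℤ, (shiftFunctor D n).Additive]
    [∀ n : ℤ, (shiftFunctor D'' n).Additive]
    [Pretriangulated D'] [Pretriangulated D] [Pretriangulated D'']
    (R : Recollement D' D D'') : Prop :=
  ¬ R.iLowStar.IsEquivalence ∧ ¬ R.jLowShriek.IsEquivalence ∧ ¬ R.jLowStar.IsEquivalence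

/-- The category `Mod-A` of right `A`-modules. -/
abbrev RightMod (A : Type u) [Ring A] : Type (u + 1) := ModuleCat.{u} Aᵐᵒᵖ

/-- The unbounded derived category `D(Mod-A)`. -/
abbrev DMod (A : Type u) [Ring A] [HasDerivedCategory.{w} (RightMod A)] : Type (u + 1) :=
  DerivedCategory (RightMod A)

/-- The regular right module `A`, as a complex concentrated in degree `0`. -/
noncomputable abbrev regular (A : Type u) [Ring A] [HasDerivedCategory.{w} (RightMod A)] :
    DMod A :=
  (DerivedCategory.singleFunctor (RightMod A) 0).obj (ModuleCat.of Aᵐᵒᵖ A)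

/-- `D^b(mod-A)` inside `D(Mod-A)`, for a finite-dimensional algebra `A`: only finitely many
cohomology modules are nonzero, and all of them are finitely generated (that is,
finite-dimensional). -/
def boundedDerived (A : Type u) [Ring A] [HasDerivedCategory.{w} (RightMod A)] :
    ObjectProperty (DMod A) := fun X =>
  {n : ℤ | ¬ IsZero ((DerivedCategory.homologyFunctor (RightMod A) n).obj X)}.Finite ∧
    ∀ n : ℤ, Module.Finite Aᵐᵒᵖ ((DerivedCategory.homologyFunctor (RightMod A) n).obj X)

/-- `K^b(P_A)` inside `D(Mod-A)`: the objects isomorphic to bounded complexes of finitely generated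
projective modules. -/
def perfect (A : Type u) [Ring A] [HasDerivedCategory.{w} (RightMod A)] :
    ObjectProperty (DMod A) := fun X =>
  ∃ K : CochainComplex (RightMod A) ℤ,
    (∃ a b : ℤ, ∀ n : ℤ, n < a ∨ b < n → IsZero (K.X n)) ∧
    (∀ n : ℤ, Module.Finite Aᵐᵒᵖ (K.X n) ∧ Module.Projective Aᵐᵒᵖ (K.X n)) ∧
    Nonempty (DerivedCategory.Q.obj K ≅ X)

/-- Self-injectivity: all projective (right) modules are injective. -/
def IsSelfInjective (A : Type u) [Ring A] : Prop :=
  ∀ P : RightMod A, Module.Projective Aᵐᵒᵖ P → Module.Injective Aᵐᵒᵖ P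

/-- The condition (#): every finitely generated non-projective (right) module `M` has
`Ext^n(M, M) ≠ 0` for infinitely many `n`. -/
def ConditionSharp (A : Type u) [Ring A] : Prop :=
  ∀ M : RightMod A, Module.Finite Aᵐᵒᵖ M → ¬ Module.Projective Aᵐᵒᵖ M →
    {n : ℕ | Nontrivial (Abelian.Ext.{u} M M n)}.Infinite

end DerivedSimple

/-! ### Morphisms between projectives or injectives in one degree and arbitrary objects of the
derived category. -/

section

open DerivedCategory HomologicalComplex

variable {C : Type u} [Category.{v} C] [Abelian C]

namespace DerivedCategory

variable [HasDerivedCategory.{w} C]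

/-! Throughout, `Hom(P[-n], X) = Hom(P, Hⁿ X)` for `P` projective and `Hom(X, E[-n]) = Hom(Hⁿ X, E)`
for `E` injective.

Part (a) is an induction on the length of the interval carrying the cohomology. A free module `P`,
put in the top degree `b` and mapping onto the top cohomology of `X`, has a cone `X₁` that is one
step shorter. Since `P` is projective and injective, a nonzero `X₁ ⟶ X₁[n]` with `n` large yields a
nonzero `X ⟶ X[n]` (`exists_ne_zero_of_distTriang`), and `X` is perfect once `X₁` is
(`perfect_of_distTriang`). A single module is settled by (#).

For part (b), put `X = i_* i^* A`. Full faithfulness and adjunction give `Hom(X, X[n]) = Hom(A,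
X[n]) = Hⁿ(X)`, so if `X` has bounded finitely generated cohomology, (a) makes it perfect.
Boundedness below: `i^* A` is small because `i_*` preserves coproducts, hence it has bounded
cohomology, and `Hⁿ(X) = Hom((i^* A)[-n], i^* A)` vanishes for `n` very negative. The rest comes
from the triangle `j_! j^* A ⟶ A ⟶ X`: `j_! C` is small, so its cohomology is bounded and finitely
generated; injectivity of `A` transfers this to finiteness of `j^* A`, and resolving `j^* A` by free
modules transfers it to `j_! j^* A`. -/

lemma Q_map_surjective_of_isKProjective (K L : CochainComplex C ℤ) [K.IsKProjective] :
    Function.Surjective (Q.map : (K ⟶ L) → _) := by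
  intro f
  obtain ⟨g, hg⟩ := (CochainComplex.IsKProjective.Qh_map_bijective K
    ((HomotopyCategory.quotient _ _).obj L)).surjective
    ((quotientCompQhIso C).hom.app K ≫ f ≫ (quotientCompQhIso C).inv.app L)
  obtain ⟨g, rfl⟩ := (HomotopyCategory.quotient _ _).map_surjective g
  refine ⟨g, ?_⟩
  rw [← cancel_epi ((quotientCompQhIso C).hom.app K), ← quotientCompQhIso_hom_naturality, hg]
  simp

lemma Q_map_surjective_of_isKInjective (K L : CochainComplex C ℤ) [L.IsKInjective] :
    Function.Surjective (Q.map : (K ⟶ L) → _) := by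
  intro f
  obtain ⟨g, hg⟩ := (CochainComplex.IsKInjective.Qh_map_bijective
    ((HomotopyCategory.quotient _ _).obj K) L).surjective
    ((quotientCompQhIso C).hom.app K ≫ f ≫ (quotientCompQhIso C).inv.app L)
  obtain ⟨g, rfl⟩ := (HomotopyCategory.quotient _ _).map_surjective g
  refine ⟨g, ?_⟩
  rw [← cancel_epi ((quotientCompQhIso C).hom.app K), ← quotientCompQhIso_hom_naturality, hg]
  simp

lemma homologyFunctor_map_Q_map_eq_iff {K L : CochainComplex C ℤ} (f : K ⟶ L) (n : ℤ)
    (φ : (homologyFunctor C n).obj (Q.obj K) ⟶ (homologyFunctor C n).obj (Q.obj L)) :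
    (homologyFunctor C n).map (Q.map f) = φ ↔
      homologyMap f n = (homologyFunctorFactors C n).inv.app K ≫ φ ≫
        (homologyFunctorFactors C n).hom.app L := by
  have h := homologyFunctorFactors_hom_naturality f n
  constructor
  · rintro rfl
    rw [h]
    exact ((homologyFunctorFactors C n).inv_hom_id_app_assoc K _).symm
  · intro hf
    rw [← cancel_mono ((homologyFunctorFactors C n).hom.app L), h, hf]
    exact (homologyFunctorFactors C n).hom_inv_id_app_assoc K _

end DerivedCategory

namespace CochainComplex

instance isKProjective_single (P : C) [Projective P] (n : ℤ) :
    ((singleFunctor C n).obj P).IsKProjective := by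
  have : ∀ m, Projective (((singleFunctor C n).obj P).X m) := fun m => by
    by_cases h : m = n
    · subst h
      exact Projective.of_iso (singleObjXSelf (.up ℤ) m P).symm inferInstance
    · have := (isZero_single_obj_X (.up ℤ) n P m h)
      exact Projective.of_iso (isZero_zero C |>.iso this) inferInstance
  exact isKProjective_of_projective _ n

instance isKInjective_single (E : C) [Injective E] (n : ℤ) :
    ((singleFunctor C n).obj E).IsKInjective := by
  have : ∀ m, Injective (((singleFunctor C n).obj E).X m) := fun m => by
    by_cases h : m = n
    · subst h
      exact Injective.of_iso (singleObjXSelf (.up ℤ) m E).symm inferInstance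
    · have := (isZero_single_obj_X (.up ℤ) n E m h)
      exact Injective.of_iso (isZero_zero C |>.iso this) inferInstance
  exact isKInjective_of_injective _ n

lemma exact_toCycles_homologyπ (K : CochainComplex C ℤ) (i j : ℤ) (h : i + 1 = j) :
    (ShortComplex.mk (K.toCycles i j) (K.homologyπ j) (by simp)).Exact :=
  ShortComplex.exact_of_g_is_cokernel _ (K.homologyIsCokernel i j (by simp [← h]))

lemma exact_homologyι_fromOpcycles (K : CochainComplex C ℤ) (i j : ℤ) (h : i + 1 = j) :
    (ShortComplex.mk (K.homologyι i) (K.fromOpcycles i j) (by simp)).Exact :=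
  ShortComplex.exact_of_f_is_kernel _ (K.homologyIsKernel i j (by simp [← h]))

/-- Projectivity lifts a map into `Hⁿ(K)` to the cycles of `K`, and a map from `P` to the `n`-cycles
is a chain map out of the complex concentrated in degree `n`. -/
lemma exists_homologyMap_eq_of_projective (P : C) [Projective P] (K : CochainComplex C ℤ) (n : ℤ)
    (φ : ((single C (.up ℤ) n).obj P).homology n ⟶ K.homology n) :
    ∃ g : (single C (.up ℤ) n).obj P ⟶ K, homologyMap g n = φ := by
  let S := (single C (.up ℤ) n).obj P
  have : IsIso (S.iCycles n) := S.isIso_iCycles n (n + 1) (by simp) (single_obj_d _ _ _ _ _)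
  have : Projective (S.cycles n) := Projective.of_iso
    ((asIso (S.iCycles n)) ≪≫ singleObjXSelf (.up ℤ) n P).symm inferInstance
  let ψ : S.cycles n ⟶ K.cycles n := Projective.factorThru (S.homologyπ n ≫ φ) (K.homologyπ n)
  have hψ : ψ ≫ K.homologyπ n = S.homologyπ n ≫ φ := Projective.factorThru_comp _ _
  let g : S ⟶ K := mkHomFromSingle ((singleObjXSelf (.up ℤ) n P).inv ≫ inv (S.iCycles n) ≫ ψ ≫
    K.iCycles n) (by simp)
  have hg : g.f n = inv (S.iCycles n) ≫ ψ ≫ K.iCycles n := by simp [g]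
  refine ⟨g, ?_⟩
  have h : cyclesMap g n = ψ := by
    rw [← cancel_mono (K.iCycles n), cyclesMap_i, hg, IsIso.hom_inv_id_assoc]
  rw [← cancel_epi (S.homologyπ n), homologyπ_naturality, h, hψ]

lemma exists_homologyMap_eq_of_injective (E : C) [Injective E] (K : CochainComplex C ℤ) (n : ℤ)
    (φ : K.homology n ⟶ ((single C (.up ℤ) n).obj E).homology n) :
    ∃ g : K ⟶ (single C (.up ℤ) n).obj E, homologyMap g n = φ := by
  let S := (single C (.up ℤ) n).obj E
  have : IsIso (S.pOpcycles n) := S.isIso_pOpcycles (n - 1) n (by simp) (single_obj_d _ _ _ _ _)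
  have : Injective (S.opcycles n) := Injective.of_iso
    ((asIso (S.pOpcycles n)).symm ≪≫ singleObjXSelf (.up ℤ) n E).symm inferInstance
  let ψ : K.opcycles n ⟶ S.opcycles n := Injective.factorThru (φ ≫ S.homologyι n) (K.homologyι n)
  have hψ : K.homologyι n ≫ ψ = φ ≫ S.homologyι n := Injective.comp_factorThru _ _
  let g : K ⟶ S := mkHomToSingle ((K.pOpcycles n ≫ ψ ≫ inv (S.pOpcycles n)) ≫
    (singleObjXSelf (.up ℤ) n E).hom)
    (by intro i _; simp only [← Category.assoc, d_pOpcycles, zero_comp])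
  have hg : g.f n = K.pOpcycles n ≫ ψ ≫ inv (S.pOpcycles n) := by simp [g]
  refine ⟨g, ?_⟩
  have h : opcyclesMap g n = ψ := by
    rw [← cancel_epi (K.pOpcycles n), p_opcyclesMap, hg, Category.assoc, Category.assoc,
      IsIso.inv_hom_id, Category.comp_id]
  rw [← cancel_mono (S.homologyι n), homologyι_naturality, h, hψ]

/-- A map that is zero on homology sends `P` into boundaries; lifting it along `K.X (n - 1) ⟶
K.cycles n` gives the homotopy. -/
lemma nonempty_homotopy_zero_of_projective (P : C) [Projective P] (K : CochainComplex C ℤ) (n : ℤ)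
    (g : (single C (.up ℤ) n).obj P ⟶ K) (hg : homologyMap g n = 0) :
    Nonempty (Homotopy g 0) := by
  let S := (single C (.up ℤ) n).obj P
  have : IsIso (S.iCycles n) := S.isIso_iCycles n (n + 1) (by simp) (single_obj_d _ _ _ _ _)
  have hπ : cyclesMap g n ≫ K.homologyπ n = 0 := by
    rw [← homologyπ_naturality, hg, comp_zero]
  let ψ : P ⟶ K.cycles n :=
    (singleObjXSelf (.up ℤ) n P).inv ≫ inv (S.iCycles n) ≫ cyclesMap g n
  have hψ : ψ ≫ K.homologyπ n = 0 := by simp only [ψ, Category.assoc, hπ, comp_zero]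
  have hψ' : ψ ≫ K.iCycles n = (singleObjXSelf (.up ℤ) n P).inv ≫ g.f n := by
    simp only [ψ, Category.assoc, cyclesMap_i, IsIso.inv_hom_id_assoc, S]
  have hex := exact_toCycles_homologyπ K (n - 1) n (by lia)
  let h : P ⟶ K.X (n - 1) := hex.liftFromProjective ψ hψ
  have hh : h ≫ K.toCycles (n - 1) n = ψ := hex.liftFromProjective_comp ψ hψ
  let z : HomComplex.Cochain ((singleFunctor C n).obj P) K (-1) :=
    HomComplex.Cochain.fromSingleMk h (show n + (-1) = n - 1 by lia)
  have hz : HomComplex.δ (-1) 0 z =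
      HomComplex.Cochain.fromSingleMk ((singleObjXSelf (.up ℤ) n P).inv ≫ g.f n) (add_zero n) := by
    rw [HomComplex.Cochain.δ_fromSingleMk _ _ 0 n (by simp), ← K.toCycles_i, reassoc_of% hh, hψ']
  have hz' : HomComplex.Cochain.fromSingleMk ((singleObjXSelf (.up ℤ) n P).inv ≫ g.f n)
      (add_zero n) = HomComplex.Cochain.ofHom g := by
    apply (HomComplex.Cochain.fromSingleEquiv (add_zero n)).injective
    rw [HomComplex.Cochain.fromSingleEquiv_fromSingleMk]
    exact congr_arg _ (HomComplex.Cochain.ofHom_v g n).symm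
  refine ⟨(HomComplex.Cochain.equivHomotopy g 0).symm ⟨z, ?_⟩⟩
  exact (hz'.symm.trans hz.symm).trans
    (by rw [HomComplex.Cochain.ofHom_zero]; exact (add_zero _).symm)

/-- Dually, the map on opcycles kills homology, so it extends along `K.opcycles n ⟶ K.X (n + 1)`,
and the extension is the homotopy. -/
lemma nonempty_homotopy_zero_of_injective (E : C) [Injective E] (K : CochainComplex C ℤ) (n : ℤ)
    (g : K ⟶ (single C (.up ℤ) n).obj E) (hg : homologyMap g n = 0) :
    Nonempty (Homotopy g 0) := by
  let S := (single C (.up ℤ) n).obj E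
  have : IsIso (S.pOpcycles n) := S.isIso_pOpcycles (n - 1) n (by simp) (single_obj_d _ _ _ _ _)
  have hι : K.homologyι n ≫ opcyclesMap g n = 0 := by
    rw [← homologyι_naturality, hg, zero_comp]
  let ψ : K.opcycles n ⟶ E :=
    opcyclesMap g n ≫ inv (S.pOpcycles n) ≫ (singleObjXSelf (.up ℤ) n E).hom
  have hψ : K.homologyι n ≫ ψ = 0 := by simp only [ψ, reassoc_of% hι, zero_comp]
  have hψ' : K.pOpcycles n ≫ ψ = g.f n ≫ (singleObjXSelf (.up ℤ) n E).hom := by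
    simp only [ψ, p_opcyclesMap_assoc, IsIso.hom_inv_id_assoc, S]
  have hex := exact_homologyι_fromOpcycles K n (n + 1) rfl
  let h : K.X (n + 1) ⟶ E := hex.descToInjective ψ hψ
  have hh : K.fromOpcycles n (n + 1) ≫ h = ψ := hex.comp_descToInjective ψ hψ
  let z : HomComplex.Cochain K ((singleFunctor C n).obj E) (-1) :=
    HomComplex.Cochain.toSingleMk h (show n + 1 + (-1) = n by lia)
  have hz : HomComplex.δ (-1) 0 z =
      HomComplex.Cochain.toSingleMk (g.f n ≫ (singleObjXSelf (.up ℤ) n E).hom) (add_zero n) := by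
    rw [HomComplex.Cochain.δ_toSingleMk _ _ 0 n (by simp), ← K.p_fromOpcycles, Category.assoc, hh,
      hψ', Int.negOnePow_zero, one_smul]
  have hz' : HomComplex.Cochain.toSingleMk (g.f n ≫ (singleObjXSelf (.up ℤ) n E).hom)
      (add_zero n) = HomComplex.Cochain.ofHom g := by
    apply (HomComplex.Cochain.toSingleEquiv (add_zero n)).injective
    rw [HomComplex.Cochain.toSingleEquiv_toSingleMk]
    exact congr_arg (· ≫ _) (HomComplex.Cochain.ofHom_v g n).symm
  refine ⟨(HomComplex.Cochain.equivHomotopy g 0).symm ⟨z, ?_⟩⟩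
  exact (hz'.symm.trans hz.symm).trans
    (by rw [HomComplex.Cochain.ofHom_zero]; exact (add_zero _).symm)

end CochainComplex

namespace DerivedCategory

open CochainComplex

variable [HasDerivedCategory.{w} C]

lemma homologyFunctor_map_bijective_of_iso {Y X X' : DerivedCategory C} (e : X ≅ X') (n : ℤ)
    (h : Function.Bijective ((homologyFunctor C n).map : (Y ⟶ X) → _)) :
    Function.Bijective ((homologyFunctor C n).map : (Y ⟶ X') → _) := by
  constructor
  · intro f g hfg
    rw [← cancel_mono e.inv]
    exact h.1 (by rw [Functor.map_comp, Functor.map_comp, hfg])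
  · intro φ
    obtain ⟨f, hf⟩ := h.2 (φ ≫ (homologyFunctor C n).map e.inv)
    exact ⟨f ≫ e.hom, by rw [Functor.map_comp, hf, Category.assoc, ← Functor.map_comp, e.inv_hom_id,
      CategoryTheory.Functor.map_id,
      Category.comp_id]⟩

lemma homologyFunctor_map_bijective_of_iso' {Y X X' : DerivedCategory C} (e : X ≅ X') (n : ℤ)
    (h : Function.Bijective ((homologyFunctor C n).map : (X ⟶ Y) → _)) :
    Function.Bijective ((homologyFunctor C n).map : (X' ⟶ Y) → _) := by
  constructor
  · intro f g hfg
    rw [← cancel_epi e.hom]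
    exact h.1 (by rw [Functor.map_comp, Functor.map_comp, hfg])
  · intro φ
    obtain ⟨f, hf⟩ := h.2 ((homologyFunctor C n).map e.hom ≫ φ)
    exact ⟨e.inv ≫ f, by rw [Functor.map_comp, hf, ← Functor.map_comp_assoc]; simp⟩

lemma homologyFunctor_map_bijective_of_homotopy (K L : CochainComplex C ℤ) (n : ℤ)
    (hQ : Function.Surjective (Q.map : (K ⟶ L) → _))
    (hs : ∀ φ : K.homology n ⟶ L.homology n, ∃ g : K ⟶ L, homologyMap g n = φ)
    (hi : ∀ g : K ⟶ L, homologyMap g n = 0 → Nonempty (Homotopy g 0)) :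
    Function.Bijective ((homologyFunctor C n).map : (Q.obj K ⟶ Q.obj L) → _) := by
  constructor
  · intro f g hfg
    rw [← sub_eq_zero] at hfg ⊢
    rw [← Functor.map_sub] at hfg
    generalize f - g = f at hfg ⊢
    obtain ⟨a, rfl⟩ := hQ f
    rw [homologyFunctor_map_Q_map_eq_iff, zero_comp, comp_zero] at hfg
    obtain ⟨h⟩ := hi a hfg
    rw [Q_map_eq_of_homotopy _ h, Q.map_zero]
  · intro φ
    obtain ⟨a, ha⟩ := hs _
    exact ⟨Q.map a, (homologyFunctor_map_Q_map_eq_iff a n φ).2 ha⟩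

lemma homologyFunctor_map_bijective_of_projective
    (P : C) [Projective P] (X : DerivedCategory C) (n : ℤ) :
    Function.Bijective ((homologyFunctor C n).map :
      ((DerivedCategory.singleFunctor C n).obj P ⟶ X) → _) :=
  homologyFunctor_map_bijective_of_iso (Q.objObjPreimageIso X) n
    (homologyFunctor_map_bijective_of_homotopy _ _ n
      (Q_map_surjective_of_isKProjective ((CochainComplex.singleFunctor C n).obj P) _)
      (exists_homologyMap_eq_of_projective P _ n) (nonempty_homotopy_zero_of_projective P _ n))

lemma homologyFunctor_map_bijective_of_injective
    (E : C) [Injective E] (X : DerivedCategory C) (n : ℤ) :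
    Function.Bijective ((homologyFunctor C n).map :
      (X ⟶ (DerivedCategory.singleFunctor C n).obj E) → _) :=
  homologyFunctor_map_bijective_of_iso' (Q.objObjPreimageIso X) n
    (homologyFunctor_map_bijective_of_homotopy _ _ n
      (Q_map_surjective_of_isKInjective _ ((CochainComplex.singleFunctor C n).obj E))
      (exists_homologyMap_eq_of_injective E _ n) (nonempty_homotopy_zero_of_injective E _ n))

end DerivedCategory

end

/-! ### Coproducts of complexes as coproducts in the derived category. -/

section

variable {C : Type u} [Category.{v} C] [Abelian C] {ι : Type w₁}

namespace CochainComplex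

open HomologicalComplex

/-- A family of complexes, as a complex of families. -/
noncomputable def family (K : ι → CochainComplex C ℤ) : CochainComplex (Discrete ι ⥤ C) ℤ where
  X n := Discrete.functor fun i => (K i).X n
  d n m := Discrete.natTrans fun i => (K i.as).d n m
  shape n m h := by ext i; exact (K i.as).shape n m h
  d_comp_d' n m p _ _ := by ext i; exact (K i.as).d_comp_d n m p

/-- The morphism of complexes of families given by a family of morphisms. -/
noncomputable def familyMap {K L : ι → CochainComplex C ℤ} (f : ∀ i, K i ⟶ L i) :
    family K ⟶ family L where
  f n := Discrete.natTrans fun i => (f i.as).f n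
  comm' n m _ := by ext i; exact (f i.as).comm n m

/-- Evaluation at an index is exact, so homology of a complex of families is computed index by
index. -/
lemma quasiIso_familyMap {K L : ι → CochainComplex C ℤ} (f : ∀ i, K i ⟶ L i)
    (hf : ∀ i, QuasiIso (f i)) : QuasiIso (familyMap f) := by
  rw [quasiIso_iff]
  intro n
  rw [quasiIsoAt_iff, ShortComplex.quasiIso_iff, NatTrans.isIso_iff_isIso_app]
  intro i
  let F := (evaluation (Discrete ι) C).obj i
  let φ := (shortComplexFunctor (Discrete ι ⥤ C) (.up ℤ) n).map (familyMap f)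
  have h : ShortComplex.QuasiIso (F.mapShortComplex.map φ) := by
    have := hf i.as
    have h1 : QuasiIsoAt (f i.as) n := inferInstance
    rwa [quasiIsoAt_iff] at h1
  rw [ShortComplex.quasiIso_iff] at h
  have h1 := ShortComplex.mapHomologyIso_hom_naturality φ F
  have h2 := @IsIso.comp_isIso _ _ _ _ _ _ (ShortComplex.mapHomologyIso _ F).hom h inferInstance
  have h3 : IsIso ((ShortComplex.mapHomologyIso _ F).hom ≫
    F.map (ShortComplex.homologyMap φ)) := h1 ▸ h2
  exact @IsIso.of_isIso_comp_left _ _ _ _ _ (ShortComplex.mapHomologyIso _ F).hom _ inferInstance h3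

variable [HasColimitsOfShape (Discrete ι) C]

/-- The coproduct of a family of complexes. -/
noncomputable def sigma (K : ι → CochainComplex C ℤ) : CochainComplex C ℤ where
  X n := ∐ fun i => (K i).X n
  d n m := Limits.Sigma.map fun i => (K i).d n m
  shape n m h := by
    apply Limits.Sigma.hom_ext
    intro i
    simp [(K i).shape n m h]
  d_comp_d' n m p _ _ := by
    apply Limits.Sigma.hom_ext
    intro i
    simp

/-- The inclusions in the coproduct of a family of complexes. -/
noncomputable def sigmaι (K : ι → CochainComplex C ℤ) (i : ι) : K i ⟶ sigma K where
  f n := Limits.Sigma.ι (fun i => (K i).X n) i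
  comm' n m _ := by simp [sigma]

/-- The morphism from a term of a coproduct of complexes given by a family of morphisms. -/
noncomputable def sigmaXDesc {K : ι → CochainComplex C ℤ} {n : ℤ} {Z : C}
    (f : ∀ i, (K i).X n ⟶ Z) : (sigma K).X n ⟶ Z :=
  Limits.Sigma.desc f

@[simp]
lemma sigmaι_f_XDesc {K : ι → CochainComplex C ℤ} {n : ℤ} {Z : C}
    (f : ∀ i, (K i).X n ⟶ Z) (i : ι) : (sigmaι K i).f n ≫ sigmaXDesc f = f i :=
  Limits.Sigma.ι_desc _ _

lemma sigmaX_hom_ext {K : ι → CochainComplex C ℤ} {n : ℤ} {Z : C} {f g : (sigma K).X n ⟶ Z}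
    (h : ∀ i, (sigmaι K i).f n ≫ f = (sigmaι K i).f n ≫ g) : f = g :=
  Limits.Sigma.hom_ext _ _ h

/-- The morphism from a coproduct of complexes given by a family of morphisms. -/
noncomputable def sigmaDesc {K : ι → CochainComplex C ℤ} {L : CochainComplex C ℤ}
    (f : ∀ i, K i ⟶ L) : sigma K ⟶ L where
  f n := sigmaXDesc fun i => (f i).f n
  comm' n m _ := by
    apply sigmaX_hom_ext
    intro i
    rw [reassoc_of% (@sigmaι_f_XDesc), Hom.comm_assoc, sigmaι_f_XDesc, Hom.comm]

@[simp]
lemma sigmaι_desc {K : ι → CochainComplex C ℤ} {L : CochainComplex C ℤ}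
    (f : ∀ i, K i ⟶ L) (i : ι) : sigmaι K i ≫ sigmaDesc f = f i := by
  ext n
  exact sigmaι_f_XDesc _ _

lemma sigma_hom_ext {K : ι → CochainComplex C ℤ} {L : CochainComplex C ℤ}
    {f g : sigma K ⟶ L} (h : ∀ i, sigmaι K i ≫ f = sigmaι K i ≫ g) : f = g := by
  ext n : 1
  exact sigmaX_hom_ext fun i => congr_hom (h i) n

/-- The coproduct is an exact functor applied to a complex of families, and exact functors preserve
quasi-isomorphisms. -/
lemma quasiIso_sigmaMap [HasExactColimitsOfShape (Discrete ι) C] {K L : ι → CochainComplex C ℤ}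
    (f : ∀ i, K i ⟶ L i) (hf : ∀ i, QuasiIso (f i)) :
    QuasiIso (sigmaDesc fun i => f i ≫ sigmaι L i) := by
  have := quasiIso_familyMap f hf
  let F : (Discrete ι ⥤ C) ⥤ C := colim
  have h : QuasiIso ((F.mapHomologicalComplex (.up ℤ)).map (familyMap f)) := inferInstance
  have h1 : (sigmaDesc fun i => f i ≫ sigmaι L i) =
      ((F.mapHomologicalComplex (.up ℤ)).map (familyMap f) : sigma K ⟶ sigma L) := by
    apply sigma_hom_ext
    intro i
    rw [sigmaι_desc]
    ext n
    exact (ι_colimMap ((familyMap f).f n) ⟨i⟩).symm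
  rw [h1]
  exact h

/-- A family of null-homotopies induces a null-homotopy on the coproduct. -/
noncomputable def sigmaHomotopy {K : ι → CochainComplex C ℤ} {L : CochainComplex C ℤ}
    (f : sigma K ⟶ L) (h : ∀ i, Homotopy (sigmaι K i ≫ f) 0) : Homotopy f 0 where
  hom n m := sigmaXDesc fun i => (h i).hom n m
  zero n m hnm := by
    apply sigmaX_hom_ext
    intro i
    rw [sigmaι_f_XDesc, comp_zero, (h i).zero n m hnm]
  comm n := by
    apply sigmaX_hom_ext
    intro i
    have := (h i).comm n
    rw [dNext_eq _ (show (ComplexShape.up ℤ).Rel n (n + 1) by simp),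
      prevD_eq _ (show (ComplexShape.up ℤ).Rel (n - 1) n by simp)] at this ⊢
    rw [Preadditive.comp_add, Preadditive.comp_add, Hom.comm_assoc, sigmaι_f_XDesc,
      reassoc_of% (@sigmaι_f_XDesc), ← comp_f, this]
    simp

end CochainComplex

namespace DerivedCategory

open CochainComplex

variable [HasDerivedCategory.{w} C]

lemma exists_quasiIso_homotopy_zero {K L : CochainComplex C ℤ} (f : K ⟶ L) (hf : Q.map f = 0) :
    ∃ (K' : CochainComplex C ℤ) (s : K' ⟶ K), QuasiIso s ∧ Nonempty (Homotopy (s ≫ f) 0) := by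
  have h : Qh.map ((HomotopyCategory.quotient _ _).map f) = Qh.map 0 := by
    rw [← cancel_mono ((quotientCompQhIso C).hom.app L), quotientCompQhIso_hom_naturality, hf]
    simp
  rw [MorphismProperty.map_eq_iff_precomp Qh (HomotopyCategory.quasiIso C (.up ℤ))] at h
  obtain ⟨X', s, hs, h⟩ := h
  obtain ⟨X', rfl⟩ := HomotopyCategory.quotient_obj_surjective X'
  obtain ⟨s, rfl⟩ := (HomotopyCategory.quotient _ _).map_surjective s
  refine ⟨X', s, ?_, ⟨HomotopyCategory.homotopyOfEq _ _ ?_⟩⟩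
  · rwa [HomotopyCategory.quotient_map_mem_quasiIso_iff] at hs
  · rw [Functor.map_comp, h, comp_zero, Functor.map_zero]

variable [HasColimitsOfShape (Discrete ι) C] [HasExactColimitsOfShape (Discrete ι) C]

/-- After writing the morphism as a fraction, each component of the numerator becomes null-homotopic
on some resolution of `K i`. The coproduct of these resolutions is still a resolution, and the
homotopies assemble on it. -/
lemma sigma_hom_ext {K : ι → CochainComplex C ℤ} {Y : DerivedCategory C}
    {f g : Q.obj (sigma K) ⟶ Y} (h : ∀ i, Q.map (sigmaι K i) ≫ f = Q.map (sigmaι K i) ≫ g) :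
    f = g := by
  rw [← sub_eq_zero]
  replace h : ∀ i, Q.map (sigmaι K i) ≫ (f - g) = 0 := fun i => by
    rw [Preadditive.comp_sub, h i, sub_self]
  generalize f - g = f at h
  rw [← cancel_mono (Q.objObjPreimageIso Y).inv, zero_comp]
  replace h : ∀ i, Q.map (sigmaι K i) ≫ f ≫ (Q.objObjPreimageIso Y).inv = 0 := fun i => by
    rw [reassoc_of% (h i), zero_comp]
  generalize f ≫ (Q.objObjPreimageIso Y).inv = f at h
  obtain ⟨Y', a, s, hs, rfl⟩ := left_fac f
  replace h : ∀ i, Q.map (sigmaι K i ≫ a) = 0 := fun i => by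
    rw [← cancel_mono (inv (Q.map s)), Q.map_comp, Category.assoc, h i, zero_comp]
  choose K' t ht hh using fun i => exists_quasiIso_homotopy_zero _ (h i)
  have := quasiIso_sigmaMap t ht
  have h2 : Homotopy ((sigmaDesc fun i => t i ≫ sigmaι K i) ≫ a) 0 :=
    sigmaHomotopy _ fun i => by
      rw [reassoc_of% (@sigmaι_desc), Category.assoc]
      exact (hh i).some
  have h3 := Q_map_eq_of_homotopy _ h2
  rw [Q.map_comp, Q.map_zero, ← cancel_epi (inv (Q.map (sigmaDesc fun i => t i ≫ sigmaι K i))),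
    IsIso.inv_hom_id_assoc, comp_zero] at h3
  rw [h3, zero_comp]

/-- Each component is a fraction; exactness of coproducts makes the coproduct of the denominators a
legitimate denominator. -/
lemma exists_sigma_desc {K : ι → CochainComplex C ℤ} {Y : DerivedCategory C}
    (f : ∀ i, Q.obj (K i) ⟶ Y) :
    ∃ g : Q.obj (sigma K) ⟶ Y, ∀ i, Q.map (sigmaι K i) ≫ g = f i := by
  choose K' s hs a ha using fun i => right_fac (f i ≫ (Q.objObjPreimageIso Y).inv)
  have := quasiIso_sigmaMap s fun i => (isIso_Q_map_iff_quasiIso _ (s i)).1 (hs i)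
  refine ⟨inv (Q.map (sigmaDesc fun i => s i ≫ sigmaι K i)) ≫ Q.map (sigmaDesc a) ≫
    (Q.objObjPreimageIso Y).hom, fun i => ?_⟩
  have h1 : Q.map (sigmaι K i) ≫ inv (Q.map (sigmaDesc fun i => s i ≫ sigmaι K i)) =
      inv (Q.map (s i)) ≫ Q.map (sigmaι K' i) := by
    rw [IsIso.comp_inv_eq, Category.assoc, ← Q.map_comp, sigmaι_desc, Q.map_comp,
      IsIso.inv_hom_id_assoc]
  rw [reassoc_of% h1, ← Q.map_comp_assoc, sigmaι_desc, ← Category.assoc, ← ha i]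
  simp

/-- A coproduct of complexes is a coproduct in the derived category. -/
noncomputable def isColimitSigma (K : ι → CochainComplex C ℤ) :
    IsColimit (Cofan.mk (Q.obj (sigma K)) fun i => Q.map (sigmaι K i)) :=
  Cofan.IsColimit.mk _ (fun s => (exists_sigma_desc s.inj).choose)
    (fun s i => (exists_sigma_desc s.inj).choose_spec i)
    (fun s m hm => sigma_hom_ext fun i => by
      rw [(exists_sigma_desc s.inj).choose_spec i]; exact hm i)

end DerivedCategory
end

/-! ### Small objects and boundedness of their cohomology. -/

section

/-- An object is small with respect to coproducts if every morphism to a coproduct is a finite sum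
of morphisms through the summands. -/
def CategoryTheory.IsSmallObject {D : Type*} [Category D] [Preadditive D] (P : D) : Prop :=
  ∀ (ι : Type) (W : ι → D) (c : Cofan W) (_ : IsColimit c) (f : P ⟶ c.pt),
    ∃ (s : Finset ι) (g : ∀ i, P ⟶ W i), f = ∑ i ∈ s, g i ≫ c.inj i

/-- A map from `F P` to a coproduct is a map from `P` to its image under `G`, which is again a
coproduct. -/
lemma CategoryTheory.IsSmallObject.of_adjunction {D D' : Type*} [Category D] [Preadditive D]
    [Category D'] [Preadditive D'] {F : D' ⥤ D} {G : D ⥤ D'} (adj : F ⊣ G) [F.Additive]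
    [∀ ι : Type, PreservesColimitsOfShape (Discrete ι) G] {P : D'} (hP : IsSmallObject P) :
    IsSmallObject (F.obj P) := by
  intro ι W c hc f
  obtain ⟨s, g, h⟩ := hP ι (fun i => G.obj (W i)) (Cofan.mk (G.obj c.pt) fun i => G.map (c.inj i))
    (isColimitCofanMkObjOfIsColimit G _ _
      (hc.ofIsoColimit (Cofan.ext (Iso.refl _) fun i => by simp)))
    (adj.homEquiv _ _ f)
  refine ⟨s, fun i => (adj.homEquiv _ _).symm (g i), ?_⟩
  replace h := ((adj.homEquiv _ _).eq_symm_apply).2 h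
  rw [h, adj.homEquiv_counit, F.map_sum, Preadditive.sum_comp]
  refine Finset.sum_congr rfl fun i _ => ?_
  change F.map (g i ≫ G.map (c.inj i)) ≫ _ = (adj.homEquiv _ _).symm (g i) ≫ _
  rw [adj.homEquiv_counit, Category.assoc, F.map_comp, Category.assoc]
  congr 1
  exact adj.counit_naturality (c.inj i)

namespace CochainComplex

open HomologicalComplex

open scoped Classical in
/-- The projections from a coproduct of complexes. -/
noncomputable def sigmaπ {C : Type u} [Category.{v} C] [Abelian C] {ι : Type w₁}
    [HasColimitsOfShape (Discrete ι) C] (K : ι → CochainComplex C ℤ) (i : ι) : sigma K ⟶ K i :=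
  sigmaDesc (Function.update 0 i (𝟙 (K i)))

@[simp]
lemma sigmaι_π_self {C : Type u} [Category.{v} C] [Abelian C] {ι : Type w₁}
    [HasColimitsOfShape (Discrete ι) C] (K : ι → CochainComplex C ℤ) (i : ι) :
    sigmaι K i ≫ sigmaπ K i = 𝟙 _ := by
  simp [sigmaπ]

open scoped Classical in
lemma sigmaι_π_of_ne {C : Type u} [Category.{v} C] [Abelian C] {ι : Type w₁}
    [HasColimitsOfShape (Discrete ι) C] (K : ι → CochainComplex C ℤ) {i j : ι} (h : i ≠ j) :
    sigmaι K i ≫ sigmaπ K j = 0 := by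
  rw [sigmaπ, sigmaι_desc, Function.update_of_ne h]
  rfl

variable {R : Type u} [Ring R]

instance (ι : Type) : HasExactColimitsOfShape (Discrete ι) (ModuleCat.{u} R) :=
  HasExactColimitsOfShape.of_domain_equivalence (ModuleCat.{u} R)
    (Discrete.equivalence (Equiv.ulift.{u} (α := ι)))

-- Allowing every finite set containing `s` is what lets the finite supports of two summands be
-- merged in the additive step.
open scoped Classical in
lemma exists_finset_sum_sigma {ι : Type} (K : ι → CochainComplex (ModuleCat.{u} R) ℤ) (n : ℤ)
    (x : (sigma K).X n) :
    ∃ s : Finset ι, ∀ t, s ⊆ t →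
      x = ∑ i ∈ t, ((sigmaπ K i).f n ≫ (sigmaι K i).f n).hom x := by
  let e := ModuleCat.coprodIsoDirectSum fun i => (K i).X n
  let p (i : ι) : (sigma K).X n →ₗ[R] (sigma K).X n := ((sigmaπ K i).f n ≫ (sigmaι K i).f n).hom
  let j : (DirectSum ι fun i => (K i).X n) →ₗ[R] (sigma K).X n := e.inv.hom
  have hj : ∀ i (y : (K i).X n), j (DirectSum.of (fun i => (K i).X n) i y) =
    ((sigmaι K i).f n).hom y := fun i y => ConcreteCategory.congr_hom
      (ModuleCat.lof_coprodIsoDirectSum_inv (fun i => (K i).X n) i) y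
  have hp : ∀ i k (y : (K i).X n), p k (((sigmaι K i).f n).hom y) =
    (((sigmaι K i ≫ sigmaπ K k ≫ sigmaι K k)).f n).hom y := fun i k y => rfl
  obtain ⟨z, rfl⟩ : ∃ z, j z = x := ⟨e.hom.hom x, ConcreteCategory.congr_hom e.hom_inv_id x⟩
  change ∃ s : Finset ι, ∀ t, s ⊆ t → j z = ∑ i ∈ t, p i (j z)
  induction z using DirectSum.induction_on with
  | zero => exact ⟨∅, fun t _ => by simp only [map_zero, Finset.sum_const_zero]⟩
  | of i y =>
    refine ⟨{i}, fun t ht => ?_⟩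
    rw [hj, Finset.sum_eq_single_of_mem i (ht (by simp)), hp, reassoc_of% (sigmaι_π_self K i)]
    intro k _ hk
    rw [hp, reassoc_of% (sigmaι_π_of_ne K hk.symm), zero_comp]
    rfl
  | add a b ha hb =>
    obtain ⟨s, hs⟩ := ha
    obtain ⟨t, ht⟩ := hb
    refine ⟨s ∪ t, fun r hr => ?_⟩
    simp only [map_add, Finset.sum_add_distrib]
    rw [← hs r (Finset.union_subset_left hr), ← ht r (Finset.union_subset_right hr)]

lemma exists_eq_sum_of_single {ι : Type} (K : ι → CochainComplex (ModuleCat.{u} R) ℤ) (n : ℤ)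
    (a : (single (ModuleCat.{u} R) (.up ℤ) n).obj (ModuleCat.of R R) ⟶ sigma K) :
    ∃ s : Finset ι, a = ∑ i ∈ s, (a ≫ sigmaπ K i) ≫ sigmaι K i := by
  let j := (singleObjXSelf (.up ℤ) n (ModuleCat.of R R)).inv
  obtain ⟨s, hs⟩ := exists_finset_sum_sigma K n ((a.f n).hom (j.hom (1 : R)))
  refine ⟨s, from_single_hom_ext ?_⟩
  rw [← cancel_epi j]
  apply ModuleCat.hom_ext
  apply LinearMap.ext_ring
  refine (hs s subset_rfl).trans ?_
  have h : (∑ i ∈ s, (a ≫ sigmaπ K i) ≫ sigmaι K i).f n =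
      ∑ i ∈ s, ((a ≫ sigmaπ K i) ≫ sigmaι K i).f n := 
    (eval (ModuleCat.{u} R) (.up ℤ) n).map_sum _ _
  rw [h, Preadditive.comp_sum, ModuleCat.hom_sum, LinearMap.sum_apply]
  rfl

/-- The `m`-th summand lives in degree `m` only, so this coproduct also behaves as a product:
infinitely many maps assemble into one. -/
lemma exists_comp_sigmaπ_eq {C : Type u} [Category.{v} C] [Abelian C]
    [HasColimitsOfShape (Discrete ℤ) C] (K : CochainComplex C ℤ) (E : ℤ → C)
    (g : ∀ m, K ⟶ (single C (.up ℤ) m).obj (E m)) :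
    ∃ f : K ⟶ sigma fun m => (single C (.up ℤ) m).obj (E m), ∀ m, f ≫ sigmaπ _ m = g m := by
  let L m := (single C (.up ℤ) m).obj (E m)
  refine ⟨{ f m := (g m).f m ≫ (sigmaι L m).f m, comm' m m' _ := ?_ }, fun m => ?_⟩
  · rw [Category.assoc, Hom.comm, single_obj_d, zero_comp, comp_zero, ← Hom.comm_assoc,
      single_obj_d, zero_comp, comp_zero]
  · apply to_single_hom_ext
    rw [comp_f, Category.assoc, ← comp_f, sigmaι_π_self, id_f, Category.comp_id]

end CochainComplex

namespace DerivedCategory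

open CochainComplex

lemma IsSmallObject.exists_comp_map_sigmaπ_eq_zero {C : Type u} [Category.{v} C] [Abelian C]
    [HasDerivedCategory.{w} C] {ι : Type} [HasColimitsOfShape (Discrete ι) C]
    [HasExactColimitsOfShape (Discrete ι) C] {P : DerivedCategory C} (hP : IsSmallObject P)
    (K : ι → CochainComplex C ℤ) (f : P ⟶ Q.obj (sigma K)) :
    ∃ s : Finset ι, ∀ i, i ∉ s → f ≫ Q.map (sigmaπ K i) = 0 := by
  obtain ⟨s, g, hg⟩ := hP ι _ _ (isColimitSigma K) f
  refine ⟨s, fun i hi => ?_⟩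
  replace hg : f = ∑ j ∈ s, g j ≫ Q.map (sigmaι K j) := hg
  rw [hg, Preadditive.sum_comp]
  refine Finset.sum_eq_zero fun j hj => ?_
  rw [Category.assoc, ← Q.map_comp, sigmaι_π_of_ne K (by rintro rfl; exact hi hj), Q.map_zero,
    comp_zero]

/-- Embed each `Hᵐ(P)` into an injective `E m` and assemble the resulting maps into one `P ⟶ ⨁ E
m[-m]`. Smallness kills almost all components, and a zero component forces `Hᵐ(P) = 0`. -/
lemma finite_setOf_not_isZero_homology {C : Type u} [Category.{v} C] [Abelian C]
    [EnoughInjectives C] [HasDerivedCategory.{w} C] [HasColimitsOfShape (Discrete ℤ) C]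
    [HasExactColimitsOfShape (Discrete ℤ) C] {P : DerivedCategory C} (hP : IsSmallObject P) :
    {n : ℤ | ¬ IsZero ((homologyFunctor C n).obj P)}.Finite := by
  let K := Q.objPreimage P
  let e : Q.obj K ≅ P := Q.objObjPreimageIso P
  let E (m : ℤ) : C := Injective.under ((homologyFunctor C m).obj (Q.obj K))
  choose g hg using fun m => (homologyFunctor_map_bijective_of_injective (E m) (Q.obj K) m).2
    (Injective.ι _ ≫ (singleFunctorCompHomologyFunctorIso C m).inv.app (E m))
  choose a ha using fun m => Q_map_surjective_of_isKInjective K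
    ((CochainComplex.singleFunctor C m).obj (E m)) (g m)
  obtain ⟨f, hf⟩ := CochainComplex.exists_comp_sigmaπ_eq K E a
  obtain ⟨s, hs⟩ := IsSmallObject.exists_comp_map_sigmaπ_eq_zero hP _ (e.inv ≫ Q.map f)
  refine s.finite_toSet.subset fun m hm => ?_
  by_contra hms
  have h := hs m hms
  rw [Category.assoc, ← Q.map_comp, hf, ← cancel_epi e.hom, e.hom_inv_id_assoc, comp_zero] at h
  have h2 : g m = 0 := (ha m).symm.trans h
  have h3 := hg m
  rw [h2, Functor.map_zero] at h3
  exact hm (((IsZero.of_mono_eq_zero _ h3.symm)).of_iso ((homologyFunctor C m).mapIso e.symm))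

variable {R : Type u} [Ring R] [HasDerivedCategory.{w} (ModuleCat.{u} R)]

instance projective_of_self : Projective (ModuleCat.of R R) :=
  (IsProjective.iff_projective R).1 inferInstance

lemma isSmallObject_Q_obj_single (n : ℤ) : IsSmallObject (Q.obj
    ((HomologicalComplex.single (ModuleCat.{u} R) (.up ℤ) n).obj (ModuleCat.of R R))) := by
  intro ι W c hc f
  let K i := Q.objPreimage (W i)
  let e i : Q.obj (K i) ≅ W i := Q.objObjPreimageIso (W i)
  obtain ⟨θ, hθ⟩ := exists_sigma_desc fun i => (e i).hom ≫ c.inj i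
  let ψ : c.pt ⟶ Q.obj (sigma K) := Cofan.IsColimit.desc hc fun i => (e i).inv ≫ Q.map (sigmaι K i)
  -- It suffices that the given coproduct is a retract of the model `sigma K`.
  have hψ : ψ ≫ θ = 𝟙 _ := Cofan.IsColimit.hom_ext hc _ _ fun i => by
    rw [Cofan.IsColimit.fac_assoc, Category.assoc, hθ, Iso.inv_hom_id_assoc, Category.comp_id]
  have hK : CochainComplex.IsKProjective
      ((HomologicalComplex.single (ModuleCat.{u} R) (.up ℤ) n).obj
    (ModuleCat.of R R)) := isKProjective_single (ModuleCat.of R R) n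
  obtain ⟨a, ha⟩ := Q_map_surjective_of_isKProjective _ _ (f ≫ ψ)
  obtain ⟨s, hs⟩ := exists_eq_sum_of_single K n a
  refine ⟨s, fun i => Q.map (a ≫ sigmaπ K i) ≫ (e i).hom, ?_⟩
  have h1 : f = Q.map a ≫ θ := by rw [ha, Category.assoc, hψ, Category.comp_id]
  have h2 : Q.map a = ∑ i ∈ s, Q.map (a ≫ sigmaπ K i) ≫ Q.map (sigmaι K i) := by
    conv_lhs => rw [hs]
    rw [Functor.map_sum]
    exact Finset.sum_congr rfl fun i _ => Q.map_comp _ _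
  rw [h1, h2, Preadditive.sum_comp]
  refine Finset.sum_congr rfl fun i _ => ?_
  simp only [Category.assoc]
  rw [hθ]

lemma isSmallObject_singleFunctor (n : ℤ) :
    IsSmallObject ((singleFunctor (ModuleCat.{u} R) n).obj (ModuleCat.of R R)) :=
  isSmallObject_Q_obj_single n

end DerivedCategory
end

/-! ### Finite generation of the cohomology of small objects. -/

section

open scoped DirectSum

variable {R : Type u} [Ring R]

/-- A direct sum of injective modules over a noetherian ring is injective. -/
lemma Module.Injective.directSum [IsNoetherianRing R] {ι : Type} (E : ι → Type u)
    [∀ i, AddCommGroup (E i)] [∀ i, Module R (E i)] [∀ i, Module.Injective R (E i)] :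
    Module.Injective R (⨁ i, E i) := by
  classical
  apply Module.Baer.injective
  intro I g
  obtain ⟨T, hT⟩ := (IsNoetherian.noetherian (⊤ : Submodule R I))
  -- The ideal is finitely generated, so `g` meets only the finitely many summands supporting the
  -- images of the generators.
  let s : Finset ι := T.biUnion fun x => DFinsupp.support (g x)
  have hs : ∀ x i, i ∉ s → g x i = 0 := fun x i hi => by
    have hx : x ∈ Submodule.span R (T : Set I) := hT ▸ Submodule.mem_top
    have : Submodule.span R (T : Set I) ≤
        LinearMap.ker ((DirectSum.component R ι E i).comp g) := by
      rw [Submodule.span_le]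
      intro y hy
      by_contra h
      exact hi (Finset.mem_biUnion.2 ⟨y, hy, DFinsupp.mem_support_iff.2 h⟩)
    exact this hx
  choose g' hg' using fun i => Module.Baer.of_injective (inferInstanceAs (Module.Injective R (E i)))
    I ((DirectSum.component R ι E i).comp g)
  refine ⟨∑ i ∈ s, (DirectSum.lof R ι E i).comp (g' i), fun x hx => ?_⟩
  ext i
  simp only [LinearMap.sum_apply, LinearMap.comp_apply, DirectSum.sum_apply]
  by_cases hi : i ∈ s
  · rw [Finset.sum_eq_single_of_mem i hi, DirectSum.lof_apply, hg' i x hx]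
    · rfl
    · intro j _ hj
      exact DirectSum.of_eq_of_ne _ _ _ hj.symm
  · rw [hs _ i hi]
    refine Finset.sum_eq_zero fun j hj => DirectSum.of_eq_of_ne _ _ _ ?_
    rintro rfl
    exact hi hj

lemma exists_linearMap_directSum_of_finite {ι : Type} {N : Type u} [AddCommGroup N] [Module R N]
    (E : ι → Type u) [∀ i, AddCommGroup (E i)] [∀ i, Module R (E i)] (g : ∀ i, N →ₗ[R] E i)
    (hg : ∀ x, {i | g i x ≠ 0}.Finite) :
    ∃ f : N →ₗ[R] ⨁ i, E i, ∀ x i, f x i = g i x := by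
  classical
  have h : ∀ x, ∃ y : ⨁ i, E i, ∀ i, y i = g i x := fun x => by
    refine ⟨∑ i ∈ (hg x).toFinset, DirectSum.of E i (g i x), fun i => ?_⟩
    rw [DirectSum.sum_apply]
    by_cases hi : g i x = 0
    · rw [hi]
      refine Finset.sum_eq_zero fun j hj => DirectSum.of_eq_of_ne _ _ _ ?_
      rintro rfl
      simp [hi] at hj
    · rw [Finset.sum_eq_single_of_mem i (by simpa using hi), DirectSum.of_eq_same]
      exact fun j _ hj => DirectSum.of_eq_of_ne _ _ _ hj.symm
  choose f hf using h
  refine ⟨⟨⟨f, fun x y => ?_⟩, fun r x => ?_⟩, hf⟩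
  · ext i
    rw [DirectSum.add_apply, hf, hf, hf, map_add]
  · ext i
    rw [RingHom.id_apply, DirectSum.smul_apply, hf, hf, map_smul]

/-- The morphism from a direct sum given by a family of morphisms. -/
noncomputable def ModuleCat.directSumDesc {ι : Type} [DecidableEq ι] {E : ι → ModuleCat.{u} R}
    {Y : ModuleCat.{u} R} (f : ∀ i, E i ⟶ Y) : ModuleCat.of R (⨁ i, E i) ⟶ Y :=
  ModuleCat.ofHom (DirectSum.toModule R ι Y fun i => (f i).hom)

open scoped Classical in
lemma CochainComplex.exists_single_directSum_comp_sigmaπ {ι : Type} (E : ι → ModuleCat.{u} R)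
    (n : ℤ) : ∃ t : (HomologicalComplex.single _ (.up ℤ) n).obj (ModuleCat.of R (⨁ i, E i)) ⟶
      sigma fun i => (HomologicalComplex.single _ (.up ℤ) n).obj (E i),
      ∀ i, t ≫ sigmaπ _ i = (HomologicalComplex.single _ (.up ℤ) n).map
        (ModuleCat.ofHom (DirectSum.component R ι (fun i => E i) i)) := by
  let L (i : ι) : CochainComplex (ModuleCat.{u} R) ℤ :=
    (HomologicalComplex.single (ModuleCat.{u} R) (.up ℤ) n).obj (E i)
  let φ : ModuleCat.of R (⨁ i, E i) ⟶ (sigma L).X n := ModuleCat.directSumDesc fun i =>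
    (HomologicalComplex.singleObjXSelf (.up ℤ) n (E i)).inv ≫ (sigmaι L i).f n
  have hd : ∀ m, (sigma L).d n m = 0 := fun m => by
    apply sigmaX_hom_ext
    intro i
    rw [HomologicalComplex.Hom.comm, HomologicalComplex.single_obj_d, zero_comp, comp_zero]
  refine ⟨HomologicalComplex.mkHomFromSingle φ fun m _ => by rw [hd, comp_zero], fun i => ?_⟩
  apply HomologicalComplex.from_single_hom_ext
  rw [HomologicalComplex.comp_f, HomologicalComplex.mkHomFromSingle_f,
    HomologicalComplex.single_map_f_self, Category.assoc]
  congr 1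
  apply ModuleCat.hom_ext
  apply DirectSum.linearMap_ext
  intro j
  ext x
  have h1 : φ.hom (DirectSum.lof R ι (fun i => E i) j x) =
      ((HomologicalComplex.singleObjXSelf (.up ℤ) n (E j)).inv ≫ (sigmaι L j).f n).hom x :=
    DirectSum.toModule_lof _ _ _
  change ((sigmaπ L i).f n).hom (φ.hom (DirectSum.lof R ι (fun i => E i) j x)) =
    (HomologicalComplex.singleObjXSelf (.up ℤ) n (E i)).inv.hom
      (DirectSum.component R ι (fun i => E i) i (DirectSum.lof R ι (fun i => E i) j x))
  rw [h1]
  change ((sigmaι L j ≫ sigmaπ L i).f n).hom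
    ((HomologicalComplex.singleObjXSelf (.up ℤ) n (E j)).inv.hom x) = _
  by_cases hij : j = i
  · subst hij
    rw [sigmaι_π_self, DirectSum.component.lof_self]
    rfl
  · rw [sigmaι_π_of_ne L hij, DirectSum.component.of, dif_neg hij, map_zero]
    rfl

namespace DerivedCategory

variable [HasDerivedCategory.{w} (ModuleCat.{u} R)]

lemma exists_singleFunctor_directSum_comp_sigmaπ {ι : Type} (E : ι → ModuleCat.{u} R) (n : ℤ) :
    ∃ t : (singleFunctor (ModuleCat.{u} R) n).obj (ModuleCat.of R (⨁ i, E i)) ⟶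
      Q.obj (CochainComplex.sigma fun i => (HomologicalComplex.single _ (.up ℤ) n).obj (E i)),
      ∀ i, t ≫ Q.map (CochainComplex.sigmaπ _ i) = (singleFunctor _ n).map
        (ModuleCat.ofHom (DirectSum.component R ι (fun i => E i) i)) := by
  obtain ⟨t, ht⟩ := CochainComplex.exists_single_directSum_comp_sigmaπ E n
  exact ⟨Q.map t, fun i => (Q.map_comp _ _).symm.trans (congr_arg Q.map (ht i))⟩

/-- The direct sum is injective, so `φ` comes from a morphism of `P` to it in degree `n`; mapping on
to the coproduct of complexes brings smallness to bear. -/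
lemma exists_finset_comp_component_eq_zero [IsNoetherianRing R]
    {P : DerivedCategory (ModuleCat.{u} R)} (hP : IsSmallObject P) {ι : Type}
    (E : ι → ModuleCat.{u} R) [∀ i, Injective (E i)] (n : ℤ)
    (φ : (homologyFunctor (ModuleCat.{u} R) n).obj P ⟶ ModuleCat.of R (⨁ i, E i)) :
    ∃ s : Finset ι, ∀ i, i ∉ s →
      φ ≫ ModuleCat.ofHom (DirectSum.component R ι (fun i => E i) i) = 0 := by
  have hE : ∀ i, Module.Injective R (E i) := fun i =>
    Module.injective_module_of_injective_object R (E i)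
  have := Module.Injective.directSum (R := R) fun i => E i
  have hinj : Injective (ModuleCat.of R (⨁ i, E i)) :=
    Module.injective_object_of_injective_module R (⨁ i, E i)
  let η := singleFunctorCompHomologyFunctorIso (ModuleCat.{u} R) n
  obtain ⟨f, hf⟩ := (homologyFunctor_map_bijective_of_injective _ P n).2 (φ ≫ η.inv.app _)
  obtain ⟨t, ht⟩ := exists_singleFunctor_directSum_comp_sigmaπ (E := E) n
  obtain ⟨s, hs⟩ := IsSmallObject.exists_comp_map_sigmaπ_eq_zero hP _ (f ≫ t)
  refine ⟨s, fun i hi => ?_⟩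
  have h1 := hs i hi
  rw [Category.assoc, ht] at h1
  have h2 : f ≫ (singleFunctor _ n).map
      (ModuleCat.ofHom (DirectSum.component R ι (fun i => E i) i)) = 0 := h1
  have h3 := η.hom.naturality (ModuleCat.ofHom (DirectSum.component R ι (fun i => E i) i))
  have h4 : (φ ≫ η.inv.app _) ≫ (homologyFunctor (ModuleCat.{u} R) n).map ((singleFunctor _ n).map
      (ModuleCat.ofHom (DirectSum.component R ι (fun i => E i) i))) = 0 := by
    rw [← hf, ← Functor.map_comp, h2, Functor.map_zero]
  have h5 := congr_arg (· ≫ η.hom.app _) h4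
  refine Eq.trans ?_ (h5.trans zero_comp)
  refine Eq.symm ((Category.assoc _ _ _).trans ((Category.assoc _ _ _).trans ?_))
  refine (congr_arg (fun g => φ ≫ η.inv.app _ ≫ g) h3).trans ?_
  exact congr_arg (φ ≫ ·) (η.inv_hom_id_app_assoc _ _)

/-- If a chain `F k` in `Hⁿ(P)` never stabilises, its union maps to `⨁ E(M / F k)`, the sum being
well defined since each element dies eventually. Extending this to all of `Hⁿ(P)` gives a map with
infinitely many nonzero components, against smallness. -/
lemma finite_homology_of_isSmallObject [IsNoetherianRing R]
    {P : DerivedCategory (ModuleCat.{u} R)} (hP : IsSmallObject P) (n : ℤ) :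
    Module.Finite R ((homologyFunctor (ModuleCat.{u} R) n).obj P) := by
  let M := (homologyFunctor (ModuleCat.{u} R) n).obj P
  change Module.Finite R M
  suffices IsNoetherian R M from inferInstance
  rw [← monotone_stabilizes_iff_noetherian]
  by_contra! hM
  obtain ⟨F, hF⟩ := hM
  let N : Submodule R M := ⨆ k, F k
  have hN : ∀ x, x ∈ N ↔ ∃ k, x ∈ F k := fun x =>
    Submodule.mem_iSup_of_directed _ F.monotone.directed_le
  let E (k : ℕ) : ModuleCat.{u} R := Injective.under (ModuleCat.of R (M ⧸ F k))
  let ε (k : ℕ) : ModuleCat.of R (M ⧸ F k) ⟶ E k := Injective.ι _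
  have hε : ∀ k, Function.Injective (ε k).hom := fun k =>
    (ModuleCat.mono_iff_injective _).1 inferInstance
  let g (k : ℕ) : N →ₗ[R] E k := (ε k).hom ∘ₗ (F k).mkQ ∘ₗ N.subtype
  have hg : ∀ k x, g k x = 0 ↔ (x : M) ∈ F k := fun k x => by
    change (ε k).hom ((F k).mkQ x) = 0 ↔ _
    rw [map_eq_zero_iff _ (hε k), Submodule.mkQ_apply, Submodule.Quotient.mk_eq_zero]
  obtain ⟨f, hf⟩ := exists_linearMap_directSum_of_finite (fun k => E k) g fun x => by
    obtain ⟨k, hk⟩ := (hN x).1 x.2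
    refine (Set.finite_Iio k).subset fun m hm => ?_
    by_contra hmk
    exact hm ((hg m x).2 (F.monotone (not_lt.1 hmk) hk))
  have hE : ∀ i, Injective (E i) := fun i => Injective.injective_under _
  have hE' : ∀ i, Module.Injective R (E i) := fun i =>
    Module.injective_module_of_injective_object R (E i) (inj := hE i)
  have := Module.Injective.directSum (R := R) fun i => E i
  obtain ⟨φ, hφ⟩ := this.out N.subtype N.injective_subtype f
  obtain ⟨s, hs⟩ := exists_finset_comp_component_eq_zero hP E n (ModuleCat.ofHom φ)
  obtain ⟨k, hk⟩ := Infinite.exists_notMem_finset s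
  obtain ⟨m, hkm, hne⟩ := hF k
  refine hne (le_antisymm (F.monotone hkm) fun x hx => ?_)
  have hxN : x ∈ N := (hN x).2 ⟨m, hx⟩
  rw [← hg k ⟨x, hxN⟩, ← hf, ← hφ]
  exact ConcreteCategory.congr_hom (hs k hk) x

end DerivedCategory
end

/-! ### Dévissage by a free module in the top degree, and perfect complexes. -/

section

open Pretriangulated

namespace DerivedCategory

section

variable {C : Type u} [Category.{v} C] [Abelian C] [HasDerivedCategory.{w} C]

/-- The homology of a shift. -/
noncomputable def homologyShiftIso (X : DerivedCategory C) (m n n' : ℤ) (h : m + n = n') :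
    (homologyFunctor C n).obj (X⟦m⟧) ≅ (homologyFunctor C n').obj X :=
  ((homologyFunctor C 0).shiftIso m n n' h).app X

/-- The shift of an object concentrated in a single degree. -/
noncomputable def singleShiftIso (M : C) (m n n' : ℤ) (h : m + n = n') :
    ((singleFunctor C n').obj M)⟦m⟧ ≅ (singleFunctor C n).obj M :=
  ((singleFunctors C).shiftIso m n n' h).app M

lemma isZero_homology_single (M : C) {m n : ℤ} (h : m ≠ n) :
    IsZero ((homologyFunctor C m).obj ((singleFunctor C n).obj M)) := by
  rcases lt_or_gt_of_ne h with h | h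
  · exact isZero_of_isGE _ n m h
  · exact isZero_of_isLE _ n m h

lemma eq_zero_of_single_shift (P : C) [Projective P] (X : DerivedCategory C) (m n n' : ℤ)
    (h : m + n = n') (hX : IsZero ((homologyFunctor C n).obj X))
    (f : ((singleFunctor C n').obj P)⟦m⟧ ⟶ X) : f = 0 := by
  rw [← cancel_epi (singleShiftIso P m n n' h).inv]
  exact (homologyFunctor_map_bijective_of_projective P X n).1 (hX.eq_of_tgt _ _)

lemma eq_zero_of_shift_single (E : C) [Injective E] (X : DerivedCategory C) (m n n' : ℤ)
    (h : m + n = n') (hX : IsZero ((homologyFunctor C n).obj X))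
    (f : X ⟶ ((singleFunctor C n').obj E)⟦m⟧) : f = 0 := by
  rw [← cancel_mono (singleShiftIso E m n n' h).hom]
  exact (homologyFunctor_map_bijective_of_injective E X n).1 (hX.eq_of_src _ _)

lemma eq_zero_of_shift_shift_single (E : C) [Injective E] (X : DerivedCategory C)
    (m m' n n' : ℤ) (h : m + m' + n = n') (hX : IsZero ((homologyFunctor C n).obj X))
    (f : X ⟶ (((singleFunctor C n').obj E)⟦m⟧)⟦m'⟧) : f = 0 :=
  (cancel_mono ((shiftFunctorAdd' (DerivedCategory C) m m' (m + m') rfl).inv.app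
    ((singleFunctor C n').obj E))).1
    ((eq_zero_of_shift_single E X (m + m') n n' h hX _).trans zero_comp.symm)

/-- Self-extensions of the cone of a morphism from a projective-injective object in degree `b`
lift to the target of this morphism, in degrees `n` that are large enough. -/
lemma exists_ne_zero_of_distTriang (P : C) [Projective P] [Injective P]
    {X X₁ : DerivedCategory C} (a b : ℤ) [X.IsGE a] [X₁.IsLE (b - 1)]
    {f : (singleFunctor C b).obj P ⟶ X} {g : X ⟶ X₁}
    {h : X₁ ⟶ ((singleFunctor C b).obj P)⟦(1 : ℤ)⟧} (hT : Triangle.mk f g h ∈ distTriang _)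
    (n : ℤ) (hn : 0 < n) (hn' : b - a ≤ n) (φ : X₁ ⟶ X₁⟦n⟧) (hφ : φ ≠ 0) :
    ∃ ψ : X ⟶ X⟦n⟧, ψ ≠ 0 := by
  -- Otherwise `φ` factors through `P[1 - b]`, which has no maps to `X₁[n]`: `H^(n+b-1)(X₁) = 0` as
  -- `n > 0`.
  have h1 : g ≫ φ ≠ 0 := fun h0 => by
    obtain ⟨ψ, hψ⟩ := Triangle.yoneda_exact₃ _ hT φ h0
    refine hφ (hψ.trans ?_)
    have : ψ = 0 := eq_zero_of_single_shift P _ 1 (b - 1) b (by lia)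
      ((isZero_of_isLE X₁ (b - 1) (n + (b - 1)) (by lia)).of_iso (homologyShiftIso _ _ _ _ rfl)) ψ
    exact (congr_arg _ this).trans comp_zero
  -- The obstruction to lifting lies in `Hom(X, P[n + 1 - b])`, which is zero by injectivity of `P`
  -- because `b - n - 1 < a`.
  obtain ⟨ψ, hψ⟩ := Triangle.coyoneda_exact₃ _ (Triangle.shift_distinguished _ hT n) (g ≫ φ)
    (eq_zero_of_shift_shift_single P X n 1 (b - n - 1) b (by lia)
      (isZero_of_isGE X a _ (by lia)) _)
  refine ⟨ψ, ?_⟩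
  rintro rfl
  exact h1 (hψ.trans zero_comp)

end

section

variable {R : Type u} [Ring R]

lemma _root_.CategoryTheory.ShortComplex.Exact.finite_X₂ [IsNoetherianRing R]
    {S : ShortComplex (ModuleCat.{u} R)} (hS : S.Exact) [Module.Finite R S.X₁]
    [Module.Finite R S.X₃] : Module.Finite R S.X₂ := by
  have : IsNoetherian R S.X₂ :=
    isNoetherian_of_range_eq_ker S.f.hom S.g.hom hS.moduleCat_range_eq_ker
  infer_instance

lemma _root_.ModuleCat.finite_of_iso {M N : ModuleCat.{u} R} (e : M ≅ N) [Module.Finite R M] :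
    Module.Finite R N :=
  Module.Finite.equiv e.toLinearEquiv

lemma _root_.ModuleCat.finite_of_isZero {M : ModuleCat.{u} R} (h : IsZero M) :
    Module.Finite R M := by
  have := ModuleCat.subsingleton_of_isZero h
  infer_instance

variable [HasDerivedCategory.{w} (ModuleCat.{u} R)]

lemma finite_homology_single (M : ModuleCat.{u} R) [Module.Finite R M] (m n : ℤ) :
    Module.Finite R ((homologyFunctor (ModuleCat.{u} R) m).obj
      ((singleFunctor (ModuleCat.{u} R) n).obj M)) := by
  by_cases h : m = n
  · subst h
    have : Module.Finite R ((𝟭 (ModuleCat.{u} R)).obj M) := inferInstanceAs (Module.Finite R M)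
    exact ModuleCat.finite_of_iso
      ((singleFunctorCompHomologyFunctorIso (ModuleCat.{u} R) m).app M).symm
  · exact ModuleCat.finite_of_isZero (isZero_homology_single M h)

instance projective_pi (r : ℕ) : Projective (ModuleCat.of R (Fin r → R)) :=
  (IsProjective.iff_projective (Fin r → R)).1 inferInstance

/-- Approximating a bounded above object with finitely generated homology by a free module placed in
the top degree. -/
lemma exists_distTriang_single_free [IsNoetherianRing R] (X : DerivedCategory (ModuleCat.{u} R))
    (b : ℤ) [X.IsLE b] (hX : ∀ n, Module.Finite R ((homologyFunctor (ModuleCat.{u} R) n).obj X)) :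
    ∃ (r : ℕ) (X₁ : DerivedCategory (ModuleCat.{u} R))
      (f : (singleFunctor _ b).obj (ModuleCat.of R (Fin r → R)) ⟶ X) (g : X ⟶ X₁)
      (h : X₁ ⟶ ((singleFunctor _ b).obj (ModuleCat.of R (Fin r → R)))⟦(1 : ℤ)⟧),
      Triangle.mk f g h ∈ distTriang _ ∧ X₁.IsLE (b - 1) ∧
      (∀ n, Module.Finite R ((homologyFunctor (ModuleCat.{u} R) n).obj X₁)) ∧
      ∀ a, a < b → X.IsGE a → X₁.IsGE a := by
  have := hX b
  obtain ⟨r, p, hp⟩ := Module.Finite.exists_fin' R ((homologyFunctor (ModuleCat.{u} R) b).obj X)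
  let P := ModuleCat.of R (Fin r → R)
  let p' : P ⟶ (homologyFunctor (ModuleCat.{u} R) b).obj X := ModuleCat.ofHom p
  have hp' : Epi p' := (ModuleCat.epi_iff_surjective _).2 hp
  obtain ⟨f, hf⟩ := (homologyFunctor_map_bijective_of_projective P X b).2
    ((singleFunctorCompHomologyFunctorIso _ b).hom.app P ≫ p')
  obtain ⟨X₁, g, h, hT⟩ := distinguished_cocone_triangle f
  have hf' : Epi ((homologyFunctor (ModuleCat.{u} R) b).map f) := by
    rw [hf]; exact epi_comp _ _
  have hg0 : (homologyFunctor (ModuleCat.{u} R) b).map g = 0 :=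
    (HomologySequence.epi_homologyMap_mor₁_iff _ hT b).1 hf'
  refine ⟨r, X₁, f, g, h, hT, (isLE_iff _ _).2 fun n hn => ?_, fun n => ?_, fun a hab hXa =>
    (isGE_iff _ _).2 fun n hn => ?_⟩
  · refine (HomologySequence.exact₃ _ hT n (n + 1) rfl).isZero_of_both_zeros ?_ ?_
    · by_cases hnb : n = b
      · subst hnb; exact hg0
      · exact (isZero_of_isLE X b n (by lia)).eq_of_src _ _
    · exact (isZero_homology_single P (by lia)).eq_of_tgt _ _
  · have h1 : Module.Finite R ((homologyFunctor (ModuleCat.{u} R) (n + 1)).obj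
      ((singleFunctor _ b).obj P)) := finite_homology_single P (n + 1) b
    have h2 := hX n
    exact @ShortComplex.Exact.finite_X₂ _ _ _ _ (HomologySequence.exact₃ _ hT n (n + 1) rfl) h2 h1
  -- Here `n + 1 ≤ a < b`, so `P` in degree `b` does not contribute; without `a < b` the kernel of
  -- the cover could appear in degree `b - 1`.
  · refine (HomologySequence.exact₃ _ hT n (n + 1) rfl).isZero_of_both_zeros ?_ ?_
    · exact (isZero_of_isGE X a n hn).eq_of_src _ _
    · exact (isZero_homology_single P (by lia)).eq_of_tgt _ _

end

end DerivedCategory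

namespace DerivedSimple

open DerivedCategory

variable {A : Type u} [Ring A]

lemma complex_single_bounded (M : RightMod A) (n : ℤ) :
    ∃ a b : ℤ, ∀ m : ℤ, m < a ∨ b < m →
      IsZero (((HomologicalComplex.single _ (.up ℤ) n).obj M).X m) :=
  ⟨n, n, fun _ _ => HomologicalComplex.isZero_single_obj_X _ _ _ _ (by lia)⟩

lemma complex_single_finite_projective (M : RightMod A) [Module.Finite Aᵐᵒᵖ M]
    [Module.Projective Aᵐᵒᵖ M] (n m : ℤ) :
    Module.Finite Aᵐᵒᵖ (((HomologicalComplex.single _ (.up ℤ) n).obj M).X m) ∧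
      Module.Projective Aᵐᵒᵖ (((HomologicalComplex.single _ (.up ℤ) n).obj M).X m) := by
  by_cases h : m = n
  · subst h
    let e := (HomologicalComplex.singleObjXSelf (.up ℤ) m M).symm.toLinearEquiv
    exact ⟨Module.Finite.equiv e, Module.Projective.of_equiv e⟩
  · have := ModuleCat.subsingleton_of_isZero
      (HomologicalComplex.isZero_single_obj_X (.up ℤ) n M m h)
    exact ⟨inferInstance, inferInstance⟩

variable [HasDerivedCategory.{w} (RightMod A)]

lemma perfect_of_iso {X Y : DMod A} (e : X ≅ Y) (hX : perfect A X) : perfect A Y := by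
  obtain ⟨K, hb, hp, ⟨i⟩⟩ := hX
  exact ⟨K, hb, hp, ⟨i ≪≫ e⟩⟩

lemma perfect_single (M : RightMod A) [Module.Finite Aᵐᵒᵖ M] [Module.Projective Aᵐᵒᵖ M] (n : ℤ) :
    perfect A ((singleFunctor (RightMod A) n).obj M) :=
  ⟨_, complex_single_bounded M n, complex_single_finite_projective M n, ⟨Iso.refl _⟩⟩

lemma perfect_shift (X : DMod A) (m : ℤ) (hX : perfect A X) : perfect A (X⟦m⟧) := by
  obtain ⟨K, ⟨a, b, hb⟩, hp, ⟨i⟩⟩ := hX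
  exact ⟨K⟦m⟧, ⟨a - m, b - m, fun n hn => hb (n + m) (by lia)⟩, fun n => hp (n + m),
    ⟨(Q.commShiftIso m).app K ≪≫ (shiftFunctor _ m).mapIso i⟩⟩

lemma perfect_Q_obj_mappingCone {K L : CochainComplex (RightMod A) ℤ} (f : K ⟶ L)
    (hKb : ∃ a b : ℤ, ∀ n : ℤ, n < a ∨ b < n → IsZero (K.X n))
    (hK : ∀ n : ℤ, Module.Finite Aᵐᵒᵖ (K.X n) ∧ Module.Projective Aᵐᵒᵖ (K.X n))
    (hLb : ∃ a b : ℤ, ∀ n : ℤ, n < a ∨ b < n → IsZero (L.X n))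
    (hL : ∀ n : ℤ, Module.Finite Aᵐᵒᵖ (L.X n) ∧ Module.Projective Aᵐᵒᵖ (L.X n)) :
    perfect A (Q.obj (CochainComplex.mappingCone f)) := by
  obtain ⟨a, b, hKb⟩ := hKb
  obtain ⟨c, d, hLb⟩ := hLb
  let e (n : ℤ) := HomologicalComplex.homotopyCofiber.XIsoBiprod f n (n + 1) rfl
  refine ⟨CochainComplex.mappingCone f, ⟨min (a - 1) c, max b d, fun n hn => ?_⟩, fun n => ?_,
    ⟨Iso.refl _⟩⟩
  · refine IsZero.of_iso ?_ (e n)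
    refine (biprod_isZero_iff _ _).2 ⟨hKb _ (by rcases hn with h | h <;> [left; right] <;> lia),
      hLb _ (by rcases hn with h | h <;> [left; right] <;> lia)⟩
  · have := (hK (n + 1)).1
    have := (hK (n + 1)).2
    have := (hL n).1
    have := (hL n).2
    let e' := (e n ≪≫ ModuleCat.biprodIsoProd _ _).symm.toLinearEquiv
    exact ⟨Module.Finite.equiv e', Module.Projective.of_equiv e'⟩

/-- Up to a shift, `X` is the cone of `X₁ ⟶ P[1 - b]`. Injectivity of `P` makes this an honest chain
map from a perfect model of `X₁`, so its mapping cone is a perfect model. -/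
lemma perfect_of_distTriang (P : RightMod A) [Module.Finite Aᵐᵒᵖ P] [Module.Projective Aᵐᵒᵖ P]
    [Injective P] {X X₁ : DMod A} (b : ℤ) {f : (singleFunctor (RightMod A) b).obj P ⟶ X}
    {g : X ⟶ X₁} {h : X₁ ⟶ ((singleFunctor (RightMod A) b).obj P)⟦(1 : ℤ)⟧}
    (hT : Triangle.mk f g h ∈ distTriang _) (hX₁ : perfect A X₁) : perfect A X := by
  obtain ⟨K, hb, hp, ⟨i⟩⟩ := hX₁
  let L : CochainComplex (RightMod A) ℤ := (HomologicalComplex.single _ (.up ℤ) (b - 1)).obj P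
  let j : ((singleFunctor (RightMod A) b).obj P)⟦(1 : ℤ)⟧ ≅ Q.obj L :=
    singleShiftIso P 1 (b - 1) b (by lia)
  have hL : L.IsKInjective := CochainComplex.isKInjective_single P (b - 1)
  obtain ⟨γ, hγ⟩ := Q_map_surjective_of_isKInjective K L (i.hom ≫ h ≫ j.hom)
  have hLb := complex_single_bounded P (b - 1)
  have hL' := complex_single_finite_projective P (b - 1)
  have h₁ := rot_of_distTriang _ (rot_of_distTriang _ hT)
  have h₂ := mappingCone_triangle_distinguished γ
  let e := Pretriangulated.isoTriangleOfIso₁₂ _ _ h₂ h₁ i j.symm (by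
    refine (congr_arg (· ≫ j.inv) hγ).trans ?_
    simp only [Category.assoc, Iso.hom_inv_id, Category.comp_id]
    rfl)
  have e₃ : Q.obj (CochainComplex.mappingCone γ) ≅ X⟦(1 : ℤ)⟧ := Triangle.π₃.mapIso e
  exact perfect_of_iso (shiftShiftNeg X (1 : ℤ))
    (perfect_shift _ (-1) (perfect_of_iso e₃ (perfect_Q_obj_mappingCone γ hb hp hLb hL')))

end DerivedSimple
end

/-! ### The dichotomy between perfect objects and infinitely many self-extensions. -/

section

open Pretriangulated

namespace DerivedCategory

lemma exists_shiftedHom_ne_zero_of_iso {C : Type*} [Category* C] [HasZeroMorphisms C] [HasShift C ℤ]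
    {X Y : C} (e : X ≅ Y) {n : ℤ} (h : ∃ f : X ⟶ X⟦n⟧, f ≠ 0) : ∃ f : Y ⟶ Y⟦n⟧, f ≠ 0 := by
  obtain ⟨f, hf⟩ := h
  refine ⟨e.inv ≫ f ≫ e.hom⟦n⟧', fun h0 => hf ?_⟩
  rw [← cancel_mono (e.hom⟦n⟧'), ← cancel_epi e.inv, h0, zero_comp, comp_zero]

lemma exists_shiftedHom_shift_ne_zero {C : Type*} [Category* C] [Preadditive C] [HasShift C ℤ]
    [∀ n : ℤ, (shiftFunctor C n).Additive]
    (X : C) (m : ℤ) {n : ℤ} (h : ∃ f : X ⟶ X⟦n⟧, f ≠ 0) : ∃ f : X⟦m⟧ ⟶ X⟦m⟧⟦n⟧, f ≠ 0 := by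
  obtain ⟨f, hf⟩ := h
  refine ⟨f⟦m⟧' ≫ (shiftComm X n m).hom, fun h0 => hf ?_⟩
  rw [← cancel_mono (shiftComm X n m).inv, zero_comp, Category.assoc, Iso.hom_inv_id,
    Category.comp_id] at h0
  exact (shiftFunctor C m).map_injective (h0.trans (Functor.map_zero _ _ _).symm)

end DerivedCategory

namespace DerivedSimple

open DerivedCategory

variable {A : Type u} [Ring A] [HasDerivedCategory.{w} (RightMod A)]

lemma perfect_single_or_exists_shiftedHom (hsharp : ConditionSharp A) (M : RightMod A)
    [Module.Finite Aᵐᵒᵖ M] (a : ℤ) :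
    perfect A ((singleFunctor (RightMod A) a).obj M) ∨ ∀ m : ℤ, ∃ n, m ≤ n ∧
      ∃ f : (singleFunctor (RightMod A) a).obj M ⟶ ((singleFunctor (RightMod A) a).obj M)⟦n⟧,
        f ≠ 0 := by
  by_cases hM : Module.Projective Aᵐᵒᵖ M
  · exact Or.inl (perfect_single M a)
  refine Or.inr fun m => ?_
  obtain ⟨n, hn, hmn⟩ := (hsharp M inferInstance hM).exists_gt m.toNat
  refine ⟨n, by lia, exists_shiftedHom_ne_zero_of_iso (singleShiftIso M (-a) a 0 (by lia))
    (exists_shiftedHom_shift_ne_zero _ (-a) ?_)⟩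
  have : Nontrivial (Abelian.Ext.{u} M M n) := hn
  have : Nontrivial (ShiftedHom ((singleFunctor (RightMod A) 0).obj M)
    ((singleFunctor (RightMod A) 0).obj M) (n : ℤ)) := Abelian.Ext.homEquiv.symm.nontrivial
  exact exists_ne (0 : ShiftedHom ((singleFunctor (RightMod A) 0).obj M)
    ((singleFunctor (RightMod A) 0).obj M) (n : ℤ))

/-- Self-extensions are asked for in arbitrarily large degrees, since only large ones pass from the
cone back to `X`. -/
lemma perfect_or_exists_shiftedHom_of_isGE_of_isLE [IsNoetherianRing Aᵐᵒᵖ]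
    (hinj : IsSelfInjective A) (hsharp : ConditionSharp A) (N : ℕ) (a : ℤ) (X : DMod A)
    [X.IsGE a] [X.IsLE (a + N)]
    (hX : ∀ n, Module.Finite Aᵐᵒᵖ ((homologyFunctor (RightMod A) n).obj X)) :
    perfect A X ∨ ∀ m : ℤ, ∃ n, m ≤ n ∧ ∃ f : X ⟶ X⟦n⟧, f ≠ 0 := by
  induction N generalizing X with
  | zero =>
    have : X.IsLE a := by simpa using ‹X.IsLE (a + (0 : ℕ))›
    obtain ⟨M, ⟨e⟩⟩ := exists_iso_singleFunctor_obj_of_isGE_of_isLE X a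
    have := hX a
    have : Module.Finite Aᵐᵒᵖ M := ModuleCat.finite_of_iso
      ((homologyFunctor (RightMod A) a).mapIso e ≪≫
        (singleFunctorCompHomologyFunctorIso (RightMod A) a).app M)
    rcases perfect_single_or_exists_shiftedHom hsharp M a with h | h
    · exact Or.inl (perfect_of_iso e.symm h)
    · refine Or.inr fun m => ?_
      obtain ⟨n, hmn, h'⟩ := h m
      exact ⟨n, hmn, exists_shiftedHom_ne_zero_of_iso e.symm h'⟩
  | succ N ih =>
    obtain ⟨r, X₁, f, g, h, hT, hLE, hfin, hGE⟩ :=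
      exists_distTriang_single_free X (a + (N + 1 : ℕ)) hX
    have : X₁.IsGE a := hGE a (by lia) inferInstance
    have : X₁.IsLE (a + N) := by
      have e : a + (N + 1 : ℕ) - 1 = a + N := by lia
      rwa [e] at hLE
    have : Module.Injective Aᵐᵒᵖ (ModuleCat.of Aᵐᵒᵖ (Fin r → Aᵐᵒᵖ)) :=
      hinj _ (inferInstanceAs (Module.Projective Aᵐᵒᵖ (Fin r → Aᵐᵒᵖ)))
    have : Injective (ModuleCat.of Aᵐᵒᵖ (Fin r → Aᵐᵒᵖ)) :=
      Module.injective_object_of_injective_module _ _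
    have : Module.Finite Aᵐᵒᵖ (ModuleCat.of Aᵐᵒᵖ (Fin r → Aᵐᵒᵖ)) :=
      inferInstanceAs (Module.Finite Aᵐᵒᵖ (Fin r → Aᵐᵒᵖ))
    have : Module.Projective Aᵐᵒᵖ (ModuleCat.of Aᵐᵒᵖ (Fin r → Aᵐᵒᵖ)) :=
      inferInstanceAs (Module.Projective Aᵐᵒᵖ (Fin r → Aᵐᵒᵖ))
    rcases ih X₁ hfin with h | h
    · exact Or.inl (perfect_of_distTriang _ _ hT h)
    · refine Or.inr fun m => ?_
      -- The lift requires `n > 0` and `n ≥ b - a = N + 1`.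
      obtain ⟨n, hmn, φ, hφ⟩ := h (max m (N + 2))
      exact ⟨n, by lia,
        exists_ne_zero_of_distTriang _ a (a + (N + 1 : ℕ)) hT n (by lia) (by lia) φ hφ⟩

lemma _root_.DerivedCategory.exists_isLE_of_finite {C : Type u} [Category.{v} C] [Abelian C]
    [HasDerivedCategory.{w} C] (X : DerivedCategory C)
    (hX : {n : ℤ | ¬ IsZero ((homologyFunctor C n).obj X)}.Finite) : ∃ b : ℤ, X.IsLE b := by
  obtain ⟨b, hb⟩ := hX.bddAbove
  exact ⟨b, (isLE_iff _ _).2 fun n hn => by_contra fun h => by have := hb h; lia⟩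

lemma _root_.DerivedCategory.exists_isGE_of_finite {C : Type u} [Category.{v} C] [Abelian C]
    [HasDerivedCategory.{w} C] (X : DerivedCategory C)
    (hX : {n : ℤ | ¬ IsZero ((homologyFunctor C n).obj X)}.Finite) : ∃ a : ℤ, X.IsGE a := by
  obtain ⟨b, hb⟩ := hX.bddBelow
  exact ⟨b, (isGE_iff _ _).2 fun n hn => by_contra fun h => by have := hb h; lia⟩

lemma perfect_or_infinite [IsNoetherianRing Aᵐᵒᵖ] (hinj : IsSelfInjective A)
    (hsharp : ConditionSharp A) (X : DMod A) (hX : boundedDerived A X) :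
    perfect A X ∨ {n : ℤ | Nontrivial (X ⟶ X⟦n⟧)}.Infinite := by
  obtain ⟨hX, hfin⟩ := hX
  obtain ⟨b, hb⟩ := exists_isLE_of_finite X hX
  obtain ⟨a, ha⟩ := exists_isGE_of_finite X hX
  have : X.IsLE (a + (b - a).toNat) := (isLE_iff _ _).2 fun n hn => isZero_of_isLE X b n (by lia)
  refine (perfect_or_exists_shiftedHom_of_isGE_of_isLE hinj hsharp (b - a).toNat a X hfin).imp_right
    fun h => Set.infinite_of_not_bddAbove ?_
  rintro ⟨m, hm⟩
  obtain ⟨n, hmn, f, hf⟩ := h (m + 1)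
  have := hm (nontrivial_of_ne f 0 hf)
  lia

end DerivedSimple
end

/-! ### Finite generation of morphism groups over endomorphisms. -/

section

open Pretriangulated

namespace DerivedCategory

section

variable {C : Type u} [Category.{v} C] [Abelian C] [HasDerivedCategory.{w} C]

instance _root_.HomologicalComplex.homologyFunctor_linear (k : Type*) [Semiring k] [Linear k C]
    (n : ℤ) : (HomologicalComplex.homologyFunctor C (.up ℤ) n).Linear k where
  map_smul f r := ShortComplex.homologyMap_smul
    ((HomologicalComplex.shortComplexFunctor C (.up ℤ) n).map f) r

instance homologyFunctor_linear (k : Type*) [Ring k] [Linear k C] (n : ℤ) :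
    (homologyFunctor C n).Linear k := by
  have : Localization.Lifting Q (HomologicalComplex.quasiIso C (ComplexShape.up ℤ))
      (HomologicalComplex.homologyFunctor C (.up ℤ) n) (homologyFunctor C n) :=
    ⟨homologyFunctorFactors C n⟩
  rw [← Localization.functor_linear_iff
    Q (HomologicalComplex.quasiIso C (ComplexShape.up ℤ)) k
    (HomologicalComplex.homologyFunctor C (.up ℤ) n) (homologyFunctor C n)]
  infer_instance

end

section

open scoped ModuleCat

variable {R : Type u} [Ring R] [HasDerivedCategory.{w} (ModuleCat.{u} R)]

/-- `Hom(P, E[-n])` is a space of maps between finite-dimensional homology modules, and scalars act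
through `c • 𝟙 P`. Taking endomorphisms of `P` as coefficients lets the statement cross functors not
known to be `k`-linear. -/
lemma exists_finite_generators_of_injective (k : Type v) [Field k] [Algebra k R]
    [FiniteDimensional k R]
    (P : DerivedCategory (ModuleCat.{u} R)) (E : ModuleCat.{u} R) [Injective E] [Module.Finite R E]
    (n : ℤ) [Module.Finite R ((homologyFunctor (ModuleCat.{u} R) n).obj P)] :
    ∃ (m : ℕ) (b : Fin m → (P ⟶ (singleFunctor _ n).obj E)),
      ∀ f, ∃ e : Fin m → (P ⟶ P), f = ∑ i, e i ≫ b i := by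
  let M := (homologyFunctor (ModuleCat.{u} R) n).obj P
  let E' := (homologyFunctor (ModuleCat.{u} R) n).obj ((singleFunctor _ n).obj E)
  have h1 : Module.Finite R E' := finite_homology_single E n n
  have h2 : Module.Finite k M := Module.Finite.trans R M
  have h3 : Module.Finite k E' := Module.Finite.trans R E'
  have h4 : Module.Finite k (M →ₗ[R] E') :=
    Module.Finite.of_injective (LinearMap.restrictScalarsₗ k R M E' k)
      (LinearMap.restrictScalars_injective k)
  obtain ⟨m, b, hb⟩ := Module.Finite.exists_fin (R := k) (M := M →ₗ[R] E')
  choose b' hb' using fun i => (homologyFunctor_map_bijective_of_injective E P n).2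
    (ModuleCat.ofHom (b i))
  refine ⟨m, b', fun f => ?_⟩
  obtain ⟨c, hc⟩ := (Submodule.mem_span_range_iff_exists_fun k).1
    (hb ▸ Submodule.mem_top : ((homologyFunctor (ModuleCat.{u} R) n).map f).hom ∈
      Submodule.span k (Set.range b))
  refine ⟨fun i => c i • 𝟙 P, (homologyFunctor_map_bijective_of_injective E P n).1 ?_⟩
  apply ModuleCat.hom_ext
  rw [← hc, Functor.map_sum, ModuleCat.hom_sum]
  refine Finset.sum_congr rfl fun i _ => ?_
  rw [Linear.smul_comp, Category.id_comp, Functor.map_smul, hb']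
  rfl

end

end DerivedCategory
end

/-! ### Adjunctions, and test objects that detect cohomology. -/

section

open Pretriangulated

/-- Fullness turns the coefficients, endomorphisms of `F P`, into endomorphisms of `P`. -/
lemma CategoryTheory.Adjunction.exists_finite_generators {D D' : Type*} [Category* D]
    [Preadditive D]
    [Category* D'] [Preadditive D'] {F : D' ⥤ D} {G : D ⥤ D'} (adj : F ⊣ G) [F.Additive] [F.Full]
    {P : D'} {Y : D} {m : ℕ} (b : Fin m → (F.obj P ⟶ Y))
    (hb : ∀ f, ∃ e : Fin m → (F.obj P ⟶ F.obj P), f = ∑ i, e i ≫ b i) :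
    ∃ b' : Fin m → (P ⟶ G.obj Y), ∀ f, ∃ e : Fin m → (P ⟶ P), f = ∑ i, e i ≫ b' i := by
  have := adj.right_adjoint_additive
  refine ⟨fun i => adj.homEquiv _ _ (b i), fun f => ?_⟩
  obtain ⟨e, he⟩ := hb ((adj.homEquiv _ _).symm f)
  choose e' he' using fun i => F.map_surjective (e i)
  refine ⟨e', ?_⟩
  have h := congr_arg (adj.homAddEquiv P Y) he
  rw [map_sum] at h
  refine ((adj.homEquiv P Y).apply_symm_apply f).symm.trans (h.trans ?_)
  refine Finset.sum_congr rfl fun i _ => ?_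
  rw [← he']
  exact adj.homEquiv_naturality_left _ _

lemma CategoryTheory.Adjunction.hom_eq_zero_iff {D D' : Type*} [Category* D] [Preadditive D]
    [Category* D'] [Preadditive D'] {F : D' ⥤ D} {G : D ⥤ D'} (adj : F ⊣ G) [F.Additive]
    {P : D'} {Y : D} : (∀ f : F.obj P ⟶ Y, f = 0) ↔ ∀ f : P ⟶ G.obj Y, f = 0 := by
  have := adj.right_adjoint_additive
  refine ⟨fun h f => ?_, fun h f => ?_⟩
  · exact (adj.homAddEquiv P Y).symm.injective ((h _).trans (h _).symm)
  · exact (adj.homAddEquiv P Y).injective ((h _).trans (h _).symm)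

/-- Additive functors send free modules to finite modules if they do so for the regular module. -/
lemma ModuleCat.finite_obj_pi {R S : Type u} [Ring R] [Ring S]
    (G : ModuleCat.{u} S ⥤ ModuleCat.{u} R) [G.Additive]
    (hG : Module.Finite R (G.obj (ModuleCat.of S S))) (r : ℕ) :
    Module.Finite R (G.obj (ModuleCat.of S (Fin r → S))) := by
  let ι (i : Fin r) : ModuleCat.of S S ⟶ ModuleCat.of S (Fin r → S) :=
    ModuleCat.ofHom (LinearMap.single S (fun _ => S) i)
  let π (i : Fin r) : ModuleCat.of S (Fin r → S) ⟶ ModuleCat.of S S :=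
    ModuleCat.ofHom (LinearMap.proj i)
  have h : 𝟙 (ModuleCat.of S (Fin r → S)) = ∑ i, π i ≫ ι i := by
    apply ModuleCat.hom_ext
    rw [ModuleCat.hom_sum]
    refine LinearMap.ext fun x => ?_
    rw [LinearMap.sum_apply]
    exact (Finset.univ_sum_single x).symm
  let Φ : (Fin r → G.obj (ModuleCat.of S S)) →ₗ[R] G.obj (ModuleCat.of S (Fin r → S)) :=
    ∑ i, (G.map (ι i)).hom ∘ₗ LinearMap.proj i
  refine Module.Finite.of_surjective Φ fun y => ⟨fun i => (G.map (π i)).hom y, ?_⟩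
  have h' := congr_arg G.map h
  rw [G.map_id, Functor.map_sum] at h'
  have h'' := congr_arg (fun f => f.hom y) h'
  refine Eq.trans ?_ h''.symm
  simp only [Φ, ModuleCat.hom_sum, LinearMap.sum_apply]
  refine Finset.sum_congr rfl fun i _ => ?_
  rw [Functor.map_comp]
  rfl

namespace DerivedCategory

section

variable {C : Type u} [Category.{v} C] [Abelian C] [HasDerivedCategory.{w} C]

lemma isZero_homology_of_injective [EnoughInjectives C] (X : DerivedCategory C) (n : ℤ)
    (h : ∀ (E : C) [Injective E] (f : X ⟶ (singleFunctor C n).obj E), f = 0) :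
    IsZero ((homologyFunctor C n).obj X) := by
  let M := (homologyFunctor C n).obj X
  let η := (singleFunctorCompHomologyFunctorIso C n).app (Injective.under M)
  obtain ⟨f, hf⟩ := (homologyFunctor_map_bijective_of_injective (Injective.under M) X n).2
    (Injective.ι M ≫ η.inv)
  have h1 : Injective.ι M ≫ η.inv = 0 := by
    rw [← hf, h _ f, Functor.map_zero]
  have h2 : Injective.ι M = 0 := by
    rw [← cancel_mono η.inv, h1, zero_comp]
  exact IsZero.of_mono_eq_zero _ h2

lemma eq_zero_of_isLE_of_isGE (X Y : DerivedCategory C) (a b : ℤ) [X.IsLE a] [Y.IsGE b]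
    (h : a < b) (f : X ⟶ Y) : f = 0 :=
  TStructure.t.zero_of_isLE_of_isGE f a b h inferInstance inferInstance

end

section

variable {R : Type u} [Ring R] [HasDerivedCategory.{w} (ModuleCat.{u} R)]

/-- The homology of the regular module in degree `n`. -/
noncomputable def homologySingleSelfEquiv (n : ℤ) :
    R ≃ₗ[R] (homologyFunctor (ModuleCat.{u} R) n).obj
      ((singleFunctor (ModuleCat.{u} R) n).obj (ModuleCat.of R R)) :=
  Iso.toLinearEquiv (X := ModuleCat.of R R)
    ((singleFunctorCompHomologyFunctorIso (ModuleCat.{u} R) n).app (ModuleCat.of R R)).symm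

lemma exists_homology_map_homologySingleSelfEquiv_one_eq (X : DerivedCategory (ModuleCat.{u} R))
    (n : ℤ) (y : (homologyFunctor (ModuleCat.{u} R) n).obj X) :
    ∃ f : (singleFunctor _ n).obj (ModuleCat.of R R) ⟶ X,
      ((homologyFunctor (ModuleCat.{u} R) n).map f).hom (homologySingleSelfEquiv n 1) = y := by
  obtain ⟨f, hf⟩ := (homologyFunctor_map_bijective_of_projective (ModuleCat.of R R) X n).2
    (ModuleCat.ofHom (LinearMap.toSpanSingleton R _ y ∘ₗ
      (homologySingleSelfEquiv (R := R) n).symm.toLinearMap))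
  refine ⟨f, ?_⟩
  rw [hf]
  simp

lemma exists_smul_homologySingleSelfEquiv_one_eq (n : ℤ)
    (x : (homologyFunctor (ModuleCat.{u} R) n).obj
      ((singleFunctor (ModuleCat.{u} R) n).obj (ModuleCat.of R R))) :
    ∃ c : R, x = c • homologySingleSelfEquiv n 1 := by
  refine ⟨(homologySingleSelfEquiv n).symm x, ?_⟩
  rw [← map_smul, smul_eq_mul, mul_one, LinearEquiv.apply_symm_apply]

/-- The regular module in degree `n` detects the homology in degree `n`. -/
lemma isZero_homology_of_single_self (X : DerivedCategory (ModuleCat.{u} R)) (n : ℤ)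
    (h : ∀ f : (singleFunctor _ n).obj (ModuleCat.of R R) ⟶ X, f = 0) :
    IsZero ((homologyFunctor (ModuleCat.{u} R) n).obj X) := by
  have key (x : (homologyFunctor (ModuleCat.{u} R) n).obj X) : x = 0 := by
    obtain ⟨f, rfl⟩ := exists_homology_map_homologySingleSelfEquiv_one_eq X n x
    rw [h f, Functor.map_zero]
    rfl
  have : Subsingleton ((homologyFunctor (ModuleCat.{u} R) n).obj X) :=
    ⟨fun x y => (key x).trans (key y).symm⟩
  exact ModuleCat.isZero_of_subsingleton _

/-- Evaluation at the generator of `Hⁿ(R[-n]) = R` turns morphisms into homology classes and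
endomorphism coefficients into ring scalars. -/
lemma finite_homology_of_finite_generators (X : DerivedCategory (ModuleCat.{u} R)) (n : ℤ) {m : ℕ}
    (b : Fin m → ((singleFunctor _ n).obj (ModuleCat.of R R) ⟶ X))
    (hb : ∀ f, ∃ e : Fin m → ((singleFunctor _ n).obj (ModuleCat.of R R) ⟶
      (singleFunctor _ n).obj (ModuleCat.of R R)), f = ∑ i, e i ≫ b i) :
    Module.Finite R ((homologyFunctor (ModuleCat.{u} R) n).obj X) := by
  rw [Module.finite_def, Submodule.fg_iff_exists_fin_generating_family]
  refine ⟨m, fun i => ((homologyFunctor (ModuleCat.{u} R) n).map (b i)).hom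
    (homologySingleSelfEquiv n 1), eq_top_iff.2 fun y _ => ?_⟩
  obtain ⟨f, rfl⟩ := exists_homology_map_homologySingleSelfEquiv_one_eq X n y
  obtain ⟨e, rfl⟩ := hb f
  rw [Functor.map_sum, ModuleCat.hom_sum, LinearMap.sum_apply]
  refine Submodule.sum_mem _ fun i _ => ?_
  rw [Functor.map_comp, ModuleCat.comp_apply]
  obtain ⟨c, hc⟩ := exists_smul_homologySingleSelfEquiv_one_eq n
    (((homologyFunctor (ModuleCat.{u} R) n).map (e i)).hom (homologySingleSelfEquiv n 1))
  rw [hc, map_smul]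
  exact Submodule.smul_mem _ _ (Submodule.subset_span ⟨i, rfl⟩)

end

end DerivedCategory
end

/-! ### Cohomological bounds for adjoint pairs, and the recollement. -/

section

open Pretriangulated

namespace DerivedCategory

variable {R S : Type u} [Ring R] [Ring S] [HasDerivedCategory.{w} (ModuleCat.{u} R)]
  [HasDerivedCategory.{w₁} (ModuleCat.{u} S)]

section

variable (F : DerivedCategory (ModuleCat.{u} S) ⥤ DerivedCategory (ModuleCat.{u} R))
  [F.CommShift ℤ]

/-- The image of an object in a single degree under a functor commuting with shifts. -/
noncomputable def objSingleIso (M : ModuleCat.{u} S) (n : ℤ) :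
    F.obj ((singleFunctor _ n).obj M) ≅ (F.obj ((singleFunctor _ 0).obj M))⟦-n⟧ :=
  F.mapIso (singleShiftIso M (-n) n 0 (by lia)).symm ≪≫ (F.commShiftIso (-n)).app _

/-- The homology of the image of an object in a single degree. -/
noncomputable def homologyObjSingleIso (M : ModuleCat.{u} S) (n m p : ℤ) (h : p + n = m) :
    (homologyFunctor (ModuleCat.{u} R) m).obj (F.obj ((singleFunctor _ n).obj M)) ≅
      (homologyFunctor (ModuleCat.{u} R) p).obj (F.obj ((singleFunctor _ 0).obj M)) :=
  (homologyFunctor (ModuleCat.{u} R) m).mapIso (objSingleIso F M n) ≪≫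
    homologyShiftIso _ (-n) m p (by lia)

variable {F} {G : DerivedCategory (ModuleCat.{u} R) ⥤ DerivedCategory (ModuleCat.{u} S)}

/-- `Hⁿ(G(E[-l]))` is `Hom(F(S)[-n], E[-l])`, which by injectivity of `E` sees only `H^(l-n)(F S)`.
-/
lemma isZero_homology_obj_single_of_adjunction (adj : F ⊣ G) [F.Additive] (E : ModuleCat.{u} R)
    [Injective E] (l n : ℤ)
    (h : IsZero ((homologyFunctor (ModuleCat.{u} R) (l - n)).obj
      (F.obj ((singleFunctor _ 0).obj (ModuleCat.of S S))))) :
    IsZero ((homologyFunctor (ModuleCat.{u} S) n).obj (G.obj ((singleFunctor _ l).obj E))) :=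
  isZero_homology_of_single_self _ n (adj.hom_eq_zero_iff.1 fun _ =>
    (homologyFunctor_map_bijective_of_injective E _ l).1 ((h.of_iso
      (homologyObjSingleIso F _ n l (l - n) (by lia))).eq_of_src _ _))

/-- Test `F Y` against injectives `E[-l]` with `l > e + c`: by adjunction these are maps from `Y ≤
e` to `G(E[-l]) ≥ l - c > e`. -/
lemma isLE_obj_of_adjunction (adj : F ⊣ G) [F.Additive] {c : ℤ}
    (hc : (F.obj ((singleFunctor _ 0).obj (ModuleCat.of S S))).IsLE c)
    (Y : DerivedCategory (ModuleCat.{u} S)) (e : ℤ) [Y.IsLE e] : (F.obj Y).IsLE (e + c) := by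
  refine (isLE_iff _ _).2 fun l hl => isZero_homology_of_injective _ _ fun E _ =>
    adj.hom_eq_zero_iff.2 fun f => ?_
  have : (G.obj ((singleFunctor _ l).obj E)).IsGE (l - c) := (isGE_iff _ _).2 fun n hn =>
    isZero_homology_obj_single_of_adjunction adj E l n (isZero_of_isLE _ c _ (by lia))
  exact eq_zero_of_isLE_of_isGE _ _ e (l - c) (by lia) f

lemma finite_homology_obj_of_adjunction [IsNoetherianRing R] [IsNoetherianRing S] (adj : F ⊣ G)
    [F.IsTriangulated] [F.Additive] {c : ℤ}
    (hc : (F.obj ((singleFunctor _ 0).obj (ModuleCat.of S S))).IsLE c)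
    (hF : ∀ n, Module.Finite R ((homologyFunctor (ModuleCat.{u} R) n).obj
      (F.obj ((singleFunctor _ 0).obj (ModuleCat.of S S)))))
    (Y : DerivedCategory (ModuleCat.{u} S)) (e l : ℤ) [Y.IsLE e]
    (hY : ∀ n, Module.Finite S ((homologyFunctor (ModuleCat.{u} S) n).obj Y)) :
    Module.Finite R ((homologyFunctor (ModuleCat.{u} R) l).obj (F.obj Y)) := by
  -- `Y` need not be bounded below. Each free cover lowers `e` by one, and once `e + c < l` the
  -- degree `l` cohomology of `F Y` is zero.
  obtain ⟨N, hN⟩ : ∃ N : ℕ, e + c - l < N := ⟨(e + c - l).toNat + 1, by lia⟩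
  induction N generalizing Y e with
  | zero =>
    have := isLE_obj_of_adjunction adj hc Y e
    exact ModuleCat.finite_of_isZero (isZero_of_isLE _ (e + c) l (by lia))
  | succ N ih =>
    obtain ⟨r, Y₁, f, g, h, hT, hLE, hfin, -⟩ := exists_distTriang_single_free Y e hY
    have h1 := ih Y₁ (e - 1) hfin (by lia)
    have h2 : Module.Finite R ((homologyFunctor (ModuleCat.{u} R) l).obj
        (F.obj ((singleFunctor _ e).obj (ModuleCat.of S (Fin r → S))))) := by
      have := hF (l - e)
      exact ModuleCat.finite_obj_pi (singleFunctor _ e ⋙ F ⋙ homologyFunctor _ l)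
        (ModuleCat.finite_of_iso (homologyObjSingleIso F _ e l (l - e) (by lia)).symm) r
    exact @ShortComplex.Exact.finite_X₂ _ _ _ _
      (HomologySequence.exact₂ _ (F.map_distinguished _ hT) l) h2 h1

lemma finite_homology_obj_single_of_adjunction (k : Type v) [Field k] [Algebra k R]
    [FiniteDimensional k R] (adj : F ⊣ G) [F.Additive] [F.Full] (E : ModuleCat.{u} R) [Injective E]
    [Module.Finite R E]
    (hF : ∀ n, Module.Finite R ((homologyFunctor (ModuleCat.{u} R) n).obj
      (F.obj ((singleFunctor _ 0).obj (ModuleCat.of S S))))) (l n : ℤ) :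
    Module.Finite S ((homologyFunctor (ModuleCat.{u} S) n).obj
      (G.obj ((singleFunctor _ l).obj E))) := by
  have := hF (l - n)
  have : Module.Finite R ((homologyFunctor (ModuleCat.{u} R) l).obj
      (F.obj ((singleFunctor _ n).obj (ModuleCat.of S S)))) :=
    ModuleCat.finite_of_iso (homologyObjSingleIso F _ n l (l - n) (by lia)).symm
  obtain ⟨m, b, hb⟩ := exists_finite_generators_of_injective k
    (F.obj ((singleFunctor _ n).obj (ModuleCat.of S S))) E l
  obtain ⟨b', hb'⟩ := adj.exists_finite_generators b hb
  exact finite_homology_of_finite_generators _ n b' hb'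

end

end DerivedCategory

namespace DerivedSimple

open DerivedCategory

variable {A B C : Type u} [Ring A] [Ring B] [Ring C] [HasDerivedCategory.{w} (RightMod A)]
  [HasDerivedCategory.{w₁} (RightMod B)] [HasDerivedCategory.{w₂} (RightMod C)]


/-- Two descriptions of the regular right module. -/
def regularIso (A : Type u) [Ring A] : ModuleCat.of Aᵐᵒᵖ Aᵐᵒᵖ ≅ ModuleCat.of Aᵐᵒᵖ A :=
  LinearEquiv.toModuleIso
    { opAddEquiv.symm with map_smul' := fun _ _ => rfl }

/-- Full faithfulness of `i_*` and the adjunction identify these morphisms with `Hom(M, (i_* i^*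
M)[n])`, where projectivity of `M` leaves only degree `n` homology. -/
lemma iLowStar_iUpStar_shiftedHom_eq_zero (R : Recollement (DMod B) (DMod A) (DMod C))
    (M : RightMod A)
    [Projective M] (n : ℤ)
    (h : IsZero ((homologyFunctor (RightMod A) n).obj
      (R.iLowStar.obj (R.iUpStar.obj ((singleFunctor _ 0).obj M)))))
    (f : R.iLowStar.obj (R.iUpStar.obj ((singleFunctor _ 0).obj M)) ⟶
      (R.iLowStar.obj (R.iUpStar.obj ((singleFunctor _ 0).obj M)))⟦n⟧) : f = 0 := by
  let Z := R.iUpStar.obj ((singleFunctor (RightMod A) 0).obj M)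
  let e : R.iLowStar.obj (Z⟦n⟧) ≅ (R.iLowStar.obj Z)⟦n⟧ := (R.iLowStar.commShiftIso n).app Z
  obtain ⟨g, hg⟩ := R.iLowStar.map_surjective (f ≫ e.inv)
  have hg0 : g = 0 := R.adj_iUpStar.hom_eq_zero_iff.2 (fun t => by
    rw [← cancel_mono e.hom, zero_comp]
    exact (homologyFunctor_map_bijective_of_projective M _ 0).1
      ((h.of_iso (homologyShiftIso _ n 0 n (by lia))).eq_of_tgt _ _)) g
  rw [← cancel_mono e.inv, ← hg, hg0, Functor.map_zero, zero_comp]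

lemma finite_setOf_not_isZero_of_isGE_of_isLE (X : DMod A) (a b : ℤ) [X.IsGE a] [X.IsLE b] :
    {n : ℤ | ¬ IsZero ((homologyFunctor (RightMod A) n).obj X)}.Finite :=
  (Set.finite_Icc a b).subset fun n hn =>
    ⟨by_contra fun h => hn (isZero_of_isGE X a n (by lia)),
      by_contra fun h => hn (isZero_of_isLE X b n (by lia))⟩

/-- The homology of `i_* i^* A` is bounded below. -/
lemma exists_isGE_iLowStar (R : Recollement (DMod B) (DMod A) (DMod C)) :
    ∃ a : ℤ, (R.iLowStar.obj (R.iUpStar.obj ((singleFunctor _ 0).obj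
      (ModuleCat.of Aᵐᵒᵖ Aᵐᵒᵖ)))).IsGE a := by
  -- As a left adjoint of `i^!`, `i_*` preserves coproducts, so its own left adjoint `i^*` preserves
  -- smallness.
  have := R.adj_iUpShriek.leftAdjoint_preservesColimits
  let Z := R.iUpStar.obj ((singleFunctor (RightMod A) 0).obj (ModuleCat.of Aᵐᵒᵖ Aᵐᵒᵖ))
  have hZ : IsSmallObject Z := .of_adjunction R.adj_iUpStar (isSmallObject_singleFunctor 0)
  obtain ⟨a, ha⟩ := exists_isGE_of_finite Z (finite_setOf_not_isZero_homology hZ)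
  obtain ⟨b, hb⟩ := exists_isLE_of_finite Z (finite_setOf_not_isZero_homology hZ)
  refine ⟨a - b, (isGE_iff _ _).2 fun n hn => isZero_homology_of_single_self _ n
    (R.adj_iUpStar.hom_eq_zero_iff.1 fun f => ?_)⟩
  let e := objSingleIso R.iUpStar (ModuleCat.of Aᵐᵒᵖ Aᵐᵒᵖ) n
  rw [← cancel_epi e.inv, comp_zero]
  -- `Z` lives in `[a, b]`, so for `n < a - b` the shift `Z[-n]` lies strictly below `Z`.
  have : (Z⟦-n⟧).IsLE (n + b) := TStructure.t.isLE_shift Z b (-n) (n + b) (by lia)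
  exact eq_zero_of_isLE_of_isGE _ _ (n + b) a (by lia) _

/-- The homology of `i_* i^* A` is bounded above and finitely generated. -/
lemma isLE_and_finite_homology_iLowStar (k : Type v) [Field k] [Algebra k A] [FiniteDimensional k A]
    [IsNoetherianRing Cᵐᵒᵖ] [Injective (ModuleCat.of Aᵐᵒᵖ Aᵐᵒᵖ)]
    (R : Recollement (DMod B) (DMod A) (DMod C)) :
    (∃ b : ℤ, (R.iLowStar.obj (R.iUpStar.obj ((singleFunctor _ 0).obj
      (ModuleCat.of Aᵐᵒᵖ Aᵐᵒᵖ)))).IsLE b) ∧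
    ∀ n, Module.Finite Aᵐᵒᵖ ((homologyFunctor (RightMod A) n).obj (R.iLowStar.obj
      (R.iUpStar.obj ((singleFunctor _ 0).obj (ModuleCat.of Aᵐᵒᵖ Aᵐᵒᵖ))))) := by
  have : FiniteDimensional k Aᵐᵒᵖ := Module.Finite.equiv (opLinearEquiv k (M := A))
  have : IsNoetherianRing Aᵐᵒᵖ := IsNoetherianRing.of_finite k Aᵐᵒᵖ
  -- The right adjoint `j_*` makes `j^*` preserve coproducts, so `j_!` preserves smallness.
  have := R.adj_jLowStar.leftAdjoint_preservesColimits
  have hP : IsSmallObject (R.jLowShriek.obj ((singleFunctor _ 0).obj (ModuleCat.of Cᵐᵒᵖ Cᵐᵒᵖ))) :=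
    .of_adjunction R.adj_jLowShriek (isSmallObject_singleFunctor 0)
  obtain ⟨c, hc⟩ := exists_isLE_of_finite _ (finite_setOf_not_isZero_homology hP)
  obtain ⟨c', hc'⟩ := exists_isGE_of_finite _ (finite_setOf_not_isZero_homology hP)
  have hF := finite_homology_of_isSmallObject hP
  let X₀ := (singleFunctor (RightMod A) 0).obj (ModuleCat.of Aᵐᵒᵖ Aᵐᵒᵖ)
  let Y := R.jUpStar.obj X₀
  have hYfin (n : ℤ) : Module.Finite Cᵐᵒᵖ ((homologyFunctor (RightMod C) n).obj Y) :=
    finite_homology_obj_single_of_adjunction k R.adj_jLowShriek (ModuleCat.of Aᵐᵒᵖ Aᵐᵒᵖ) hF 0 n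
  have hY : Y.IsLE (-c') := (isLE_iff _ _).2 fun n hn =>
    isZero_homology_obj_single_of_adjunction R.adj_jLowShriek _ 0 n
      (isZero_of_isGE _ c' _ (by lia))
  have hjY := isLE_obj_of_adjunction R.adj_jLowShriek hc Y (-c')
  have hjYfin (n : ℤ) : Module.Finite Aᵐᵒᵖ ((homologyFunctor (RightMod A) n).obj
      (R.jLowShriek.obj Y)) :=
    finite_homology_obj_of_adjunction R.adj_jLowShriek hc hF Y (-c') n hYfin
  obtain ⟨δ, hT⟩ := R.exists_triangle_star_shriek X₀
  refine ⟨⟨max 0 (-c' + c), (isLE_iff _ _).2 fun n hn => ?_⟩, fun n => ?_⟩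
  · exact (HomologySequence.exact₃ _ hT n (n + 1) rfl).isZero_of_both_zeros
      ((isZero_homology_single _ (by lia)).eq_of_src _ _)
      ((isZero_of_isLE (R.jLowShriek.obj Y) (-c' + c) (n + 1) (by lia)).eq_of_tgt _ _)
  · exact @ShortComplex.Exact.finite_X₂ _ _ _ _ (HomologySequence.exact₃ _ hT n (n + 1) rfl)
      (finite_homology_single _ n 0) (hjYfin (n + 1))

lemma perfect_iLowStar (k : Type v) [Field k] [Algebra k A] [FiniteDimensional k A]
    [IsNoetherianRing Cᵐᵒᵖ] (hinj : IsSelfInjective A) (hsharp : ConditionSharp A)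
    (R : Recollement (DMod B) (DMod A) (DMod C)) :
    perfect A (R.iLowStar.obj (R.iUpStar.obj (regular A))) := by
  have : FiniteDimensional k Aᵐᵒᵖ := Module.Finite.equiv (opLinearEquiv k (M := A))
  have : IsNoetherianRing Aᵐᵒᵖ := IsNoetherianRing.of_finite k Aᵐᵒᵖ
  have : Module.Injective Aᵐᵒᵖ (ModuleCat.of Aᵐᵒᵖ Aᵐᵒᵖ) :=
    hinj _ (inferInstanceAs (Module.Projective Aᵐᵒᵖ Aᵐᵒᵖ))
  have : Injective (ModuleCat.of Aᵐᵒᵖ Aᵐᵒᵖ) := Module.injective_object_of_injective_module _ _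
  let X := R.iLowStar.obj (R.iUpStar.obj ((singleFunctor _ 0).obj (ModuleCat.of Aᵐᵒᵖ Aᵐᵒᵖ)))
  obtain ⟨a, ha⟩ := exists_isGE_iLowStar R
  obtain ⟨⟨b, hb⟩, hfin⟩ := isLE_and_finite_homology_iLowStar k R
  have hX := finite_setOf_not_isZero_of_isGE_of_isLE X a b
  refine perfect_of_iso (R.iLowStar.mapIso (R.iUpStar.mapIso
    ((singleFunctor (RightMod A) 0).mapIso (regularIso A)))) (X := X) ?_
  -- Degrees with nonzero self-extensions lie in the finite support of the cohomology of `X`, which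
  -- excludes the second alternative.
  refine (perfect_or_infinite hinj hsharp X ⟨hX, hfin⟩).resolve_right fun h => h (hX.subset ?_)
  intro n hn h0
  obtain ⟨f, hf⟩ := @exists_ne _ hn 0
  exact hf (iLowStar_iUpStar_shiftedHom_eq_zero R _ n h0 f)

end DerivedSimple
end

open DerivedSimple in
theorem propositionp (k : Type v) [Field k]
    (A : Type u) [Ring A] [Algebra k A] [FiniteDimensional k A]
    [HasDerivedCategory.{w} (RightMod A)]
    (hinj : IsSelfInjective A) (hsharp : ConditionSharp A) :
    (∀ X : DMod A, boundedDerived A X →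
      perfect A X ∨ {n : ℤ | Nontrivial (X ⟶ X⟦n⟧)}.Infinite) ∧
    (∀ (B C : Type u) [Ring B] [Algebra k B] [FiniteDimensional k B]
      [Ring C] [Algebra k C] [FiniteDimensional k C]
      [HasDerivedCategory.{w₁} (RightMod B)] [HasDerivedCategory.{w₂} (RightMod C)]
      (R : Recollement (DMod B) (DMod A) (DMod C)), R.IsNontrivial →
      perfect A (R.iLowStar.obj (R.iUpStar.obj (regular A)))) := by
  have hA : FiniteDimensional k Aᵐᵒᵖ := Module.Finite.equiv (opLinearEquiv k (M := A))
  have : IsNoetherianRing Aᵐᵒᵖ := IsNoetherianRing.of_finite k Aᵐᵒᵖ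
  refine ⟨perfect_or_infinite hinj hsharp, ?_⟩
  intro B C _ _ _ _ _ _ _ _ R _
  have : FiniteDimensional k Cᵐᵒᵖ := Module.Finite.equiv (opLinearEquiv k (M := C))
  have : IsNoetherianRing Cᵐᵒᵖ := IsNoetherianRing.of_finite k Cᵐᵒᵖ
  exact perfect_iLowStar k hinj hsharp R
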